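/- For a prime $p\ge 3$ and a subgroup $H$ of $(\mathbb{Z}/p\mathbb{Z})^*$ of odd order $d$, let $X_p^-(H)$ be the (non-empty) finite set of Dirichlet characters $\chi$ modulo $p$ with $\chi(-1)=-1$ and $\chi(h)=1$ for all $h\in H$. For integers $q_1,q_2\ge 1$ put $$M_{q_1,q_2}(p,H)=\frac{1}{\#X_p^-(H)}\sum_{\chi\in X_p^-(H)}\chi(q_1)\overline{\chi}(q_2)\,|L(1,\chi)|^2,$$ where $L(s,\chi)$ is the Dirichlet $L$-function of $\chi$. Let $\phi$ denote Euler's totient function. (i) Let $q_1,q_2\ge 1$ be coprime integers. There is a constant $C=C(q_1,q_2)$ such that for every prime $p\ge 3$ and every subgroup $H$ of $(\mathbb{Z}/p\mathbb{Z})^*$ of odd order $d$, $$\left|M_{q_1,q_2}(p,H)-\frac{\pi^2}{6q_1q_2}\right|\le C\, d\,(\log p)^2\,p^{-1/\phi(d)}.$$ (ii) Let $q_1,q_2\ge 1$ be arbitrary integers. There is a constant $C=C(q_1,q_2)$ such that for every prime $p\ge 3$ and every subgroup $H$ of $(\mathbb{Z}/p\mathbb{Z})^*$ of odd order $d$, $$\left|M_{q_1,q_2}(p,H)-\frac{\pi^2}{6}\,\frac{\gcd(q_1,q_2)^2}{q_1q_2}\right|\le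 C\, d\,(\log p)^2\,p^{-1/\phi(d)}.$$ -/

import Mathlib

open scoped ComplexConjugate

/-- The finite set `X_f^-(H)` of odd Dirichlet characters modulo `f` that are trivial on the
subgroup `H` of `(ℤ/fℤ)ˣ`. -/
noncomputable def oddCharactersTrivialOn (f : ℕ) [NeZero f] (H : Subgroup (ZMod f)ˣ) :
    Finset (DirichletCharacter ℂ f) :=
  open Classical in
  Finset.univ.filter fun χ => χ.Odd ∧ ∀ h ∈ H, χ (h : ZMod f) = 1

/-- The twisted mean `M_{q₁,q₂}(f,H) = (1/#X_f^-(H)) ∑_{χ ∈ X_f^-(H)} χ(q₁) χ̄(q₂) |L(1,χ)|²`. -/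
noncomputable def twistedMean (q₁ q₂ f : ℕ) [NeZero f] (H : Subgroup (ZMod f)ˣ) : ℂ :=
  (1 / ((oddCharactersTrivialOn f H).card : ℂ)) *
    ∑ χ ∈ oddCharactersTrivialOn f H,
      χ (q₁ : ZMod f) * conj (χ (q₂ : ZMod f)) * ((‖χ.LFunction 1‖ ^ 2 : ℝ) : ℂ)

/-! For odd `χ` mod `p`, `L(1,χ) = (π/2p) ∑ χ(u) cot(πu/p)`. Expanding `|L(1,χ)|²` and using
orthogonality over the odd characters trivial on `H` turns the mean into `π²/(2p²) ∑_{h∈H} ∑_b cot(π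
h q₂ b/p) cot(π q₁ b/p)` (`twistedMean_eq_sum_cotResidue`). With residues of least absolute value,
`cot(πU/p)` is `p/(πU)` up to a bounded error.

The term `h = 1` gives the main term: if `U, V` are the residues of `q₂b, q₁b`, then `q₁U - q₂V` is
a multiple of `p`. If it vanishes, coprimality gives `U = q₂T, V = q₁T` with `T` the residue of `b`,
and `∑ 1/T²` tends to `2ζ(2)`. Otherwise `U` or `V` has size comparable to `p`, and the total error
is `O(p log p)`.

A term `h ≠ 1` is small because `h` has odd order `n ≥ 3`. If `x ≡ hy mod p`, then `p` divides the
homogenized cyclotomic polynomial `Φ_n(x,y)`, which is a nonzero integer of size at most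
`(|x|+|y|)^φ(n)`. Hence the lattice points `(U,V)` have sup norm at least a constant times
`p^(1/φ(d))`. This also separates them from each other, and a box count bounds `∑ 1/|UV|`.

For (ii), a common factor prime to `p` cancels; the finitely many `p` dividing `q₁q₂` are absorbed
by the constant. -/

/-! ### The odd Hurwitz zeta function at 1 and the cotangent formula for `L(1,χ)`. -/

/-- A majorant summable in `n` and uniform in `s`, for letting `s → 1⁺` under the sum. Bernoulli's
inequality for `(x/y)^s` supplies the second factor `1/(n+1)`. -/
theorem norm_rpow_neg_sub_rpow_neg_le {a s : ℝ} (ha : 0 < a) (ha1 : a < 1) (hs : 1 ≤ s)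
    (hs2 : s ≤ 2) (n : ℕ) :
    |((n : ℝ) + 1 + a) ^ (-s) - ((n : ℝ) + 1 - a) ^ (-s)| ≤
      4 * (1 - a) ^ (-2 : ℝ) * (1 / ((n : ℝ) + 1) ^ 2) := by
  have hn : (0 : ℝ) ≤ n := n.cast_nonneg
  set x : ℝ := (n : ℝ) + 1 - a with hx
  set y : ℝ := (n : ℝ) + 1 + a with hy
  have hx0 : 0 < x := by linarith
  have hy0 : 0 < y := by linarith
  have hxy : x ≤ y := by linarith
  have h1 : y ^ (-s) ≤ x ^ (-s) := Real.rpow_le_rpow_of_nonpos hx0 hxy (by linarith)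
  rw [abs_sub_comm, abs_of_nonneg (by linarith)]
  have h2 : 1 + s * (x / y - 1) ≤ (x / y) ^ s := by
    have := one_add_mul_self_le_rpow_one_add (s := x / y - 1)
      (by have : 0 ≤ x / y := by positivity
          linarith) hs
    simpa using this
  have h3 : y ^ (-s) = x ^ (-s) * (x / y) ^ s := by
    rw [Real.div_rpow hx0.le hy0.le, Real.rpow_neg hx0.le, Real.rpow_neg hy0.le]
    have := (Real.rpow_pos_of_pos hx0 s).ne'
    field_simp
  have hxs : 0 < x ^ (-s) := Real.rpow_pos_of_pos hx0 _
  have h4 : x ^ (-s) - y ^ (-s) ≤ x ^ (-s) * (4 / ((n : ℝ) + 1)) := by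
    rw [h3]
    have : 1 - (x / y) ^ s ≤ 4 / ((n : ℝ) + 1) := by
      have e : s * (x / y - 1) = - (s * (2 * a) / y) := by
        field_simp
        rw [hx, hy]; ring
      have : s * (2 * a) / y ≤ 4 / ((n : ℝ) + 1) := by
        apply div_le_div₀ (by norm_num) (by nlinarith) (by positivity) (by linarith)
      linarith
    calc x ^ (-s) - x ^ (-s) * (x / y) ^ s = x ^ (-s) * (1 - (x / y) ^ s) := by ring
      _ ≤ _ := by gcongr
  have h5 : x ^ (-s) ≤ (1 - a) ^ (-2 : ℝ) * (1 / ((n : ℝ) + 1)) := by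
    have ha' : 0 < 1 - a := by linarith
    have e1 : ((n : ℝ) + 1) * (1 - a) ≤ x := by rw [hx]; nlinarith
    calc x ^ (-s) ≤ (((n : ℝ) + 1) * (1 - a)) ^ (-s) :=
          Real.rpow_le_rpow_of_nonpos (by positivity) e1 (by linarith)
      _ = (1 - a) ^ (-s) * ((n : ℝ) + 1) ^ (-s) := by
          rw [Real.mul_rpow (by positivity) ha'.le, mul_comm]
      _ ≤ (1 - a) ^ (-2 : ℝ) * ((n : ℝ) + 1) ^ (-1 : ℝ) := by
          gcongr ?_ * ?_
          · exact Real.rpow_le_rpow_of_exponent_ge ha' (by linarith) (by linarith)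
          · exact Real.rpow_le_rpow_of_exponent_le (by linarith) (by linarith)
      _ = _ := by rw [Real.rpow_neg_one, one_div]
  calc _ ≤ x ^ (-s) * (4 / ((n : ℝ) + 1)) := h4
    _ ≤ ((1 - a) ^ (-2 : ℝ) * (1 / ((n : ℝ) + 1))) * (4 / ((n : ℝ) + 1)) := by gcongr
    _ = _ := by field_simp

theorem hasSum_hurwitzZetaOdd_sub {a s : ℝ} (ha : 0 < a) (ha1 : a < 1) (hs : 1 < s) :
    HasSum (fun n : ℕ ↦ (((((n : ℝ) + 1 + a) ^ (-s) - ((n : ℝ) + 1 - a) ^ (-s)) / 2 : ℝ) : ℂ))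
      (HurwitzZeta.hurwitzZetaOdd (a : UnitAddCircle) (s : ℂ) - ((a ^ (-s) / 2 : ℝ) : ℂ)) := by
  have h := (HurwitzZeta.hasSum_int_hurwitzZetaOdd a (s := (s : ℂ)) (by simpa using hs)).nat_add_neg
  have h' := (hasSum_nat_add_iff' 1).2 h
  have key (x : ℝ) (hx : 0 < x) : ((x : ℂ) ^ (s : ℂ))⁻¹ = ((x ^ (-s) : ℝ) : ℂ) := by
    rw [Real.rpow_neg hx.le, Complex.ofReal_inv, Complex.ofReal_cpow hx.le]
  convert! h' using 1
  · funext n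
    have hn : (0 : ℝ) ≤ n := n.cast_nonneg
    have e1 : (((n + 1 : ℕ) : ℤ) : ℝ) + a = (n : ℝ) + 1 + a := by push_cast; ring
    have e2 : ((-((n + 1 : ℕ) : ℤ) : ℤ) : ℝ) + a = -((n : ℝ) + 1 - a) := by push_cast; ring
    have p1 : 0 < (n : ℝ) + 1 + a := by linarith
    have p2 : 0 < (n : ℝ) + 1 - a := by linarith
    rw [e1, e2, abs_neg, abs_of_pos p1, abs_of_pos p2, sign_pos p1, Left.sign_neg, sign_pos p2]
    have k1 := key _ p1
    have k2 := key _ p2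
    push_cast at k1 k2 ⊢
    rw [← k1, ← k2]
    simp
    ring
  · have k1 := key _ ha
    simp only [Finset.range_one, Finset.sum_singleton, Nat.cast_zero, neg_zero, Int.cast_zero,
      zero_add, abs_of_pos ha, sign_pos ha]
    push_cast at k1 ⊢
    rw [← k1]
    simp
    ring

/-- The series representation is used for `s > 1`. Pairing `n+1` with `-(n+1)` makes it dominated up
to `s = 1`; the limit is the Mittag-Leffler expansion of the cotangent. -/
theorem hurwitzZetaOdd_one {a : ℝ} (ha : 0 < a) (ha1 : a < 1) :
    HurwitzZeta.hurwitzZetaOdd (a : UnitAddCircle) 1 =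
      ((Real.pi / 2 * Real.cot (Real.pi * a) : ℝ) : ℂ) := by
  have hmem : (a : ℂ) ∈ Complex.integerComplement := by
    rintro ⟨n, hn⟩
    have hn' : (n : ℝ) = a := by exact_mod_cast hn
    rw [← hn'] at ha ha1
    have h1 : 0 < n := by exact_mod_cast ha
    have h2 : n < 1 := by exact_mod_cast ha1
    omega
  have lim1 : Filter.Tendsto (fun s : ℝ ↦ ∑' n : ℕ,
      (((((n : ℝ) + 1 + a) ^ (-s) - ((n : ℝ) + 1 - a) ^ (-s)) / 2 : ℝ) : ℂ)) (nhdsWithin 1 (Set.Ioi 1))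
      (nhds (∑' n : ℕ,
        (((((n : ℝ) + 1 + a) ^ (-1 : ℝ) - ((n : ℝ) + 1 - a) ^ (-1 : ℝ)) / 2 : ℝ) : ℂ))) := by
    refine tendsto_tsum_of_dominated_convergence
      (bound := fun n ↦ 4 * (1 - a) ^ (-2 : ℝ) * (1 / ((n : ℝ) + 1) ^ 2)) ?_ ?_ ?_
    · refine Summable.mul_left _ ?_
      have := (summable_nat_add_iff 1).2 (Real.summable_one_div_nat_pow.2 (le_refl 2))
      simpa using this
    · intro n
      have hn : (0 : ℝ) ≤ n := n.cast_nonneg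
      refine ((Complex.continuous_ofReal.tendsto _).comp ?_)
      refine Filter.Tendsto.mono_left ?_ nhdsWithin_le_nhds
      refine Filter.Tendsto.div_const (Filter.Tendsto.sub ?_ ?_) _
      · exact tendsto_const_nhds.rpow (continuous_neg.tendsto 1) (Or.inl (by linarith))
      · exact tendsto_const_nhds.rpow (continuous_neg.tendsto 1) (Or.inl (by linarith))
    · filter_upwards [Ioo_mem_nhdsGT (show (1 : ℝ) < 2 by norm_num)] with s hs n
      rw [Complex.norm_real, Real.norm_eq_abs, abs_div, abs_two]
      have := norm_rpow_neg_sub_rpow_neg_le ha ha1 hs.1.le hs.2.le n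
      have h0 := abs_nonneg (((n : ℝ) + 1 + a) ^ (-s) - ((n : ℝ) + 1 - a) ^ (-s))
      linarith
  have lim2 : Filter.Tendsto (fun s : ℝ ↦ HurwitzZeta.hurwitzZetaOdd (a : UnitAddCircle) (s : ℂ) -
      ((a ^ (-s) / 2 : ℝ) : ℂ)) (nhdsWithin 1 (Set.Ioi 1))
      (nhds (HurwitzZeta.hurwitzZetaOdd (a : UnitAddCircle) ((1 : ℝ) : ℂ) -
        ((a ^ (-1 : ℝ) / 2 : ℝ) : ℂ))) := by
    refine Filter.Tendsto.mono_left ?_ nhdsWithin_le_nhds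
    refine Filter.Tendsto.sub ?_ ?_
    · exact ((HurwitzZeta.differentiable_hurwitzZetaOdd (a : UnitAddCircle)).continuous.comp
        Complex.continuous_ofReal).tendsto 1
    · refine ((Complex.continuous_ofReal.tendsto _).comp ?_)
      exact (tendsto_const_nhds.rpow (continuous_neg.tendsto 1) (Or.inl ha.ne')).div_const _
  have heq : (fun s : ℝ ↦ HurwitzZeta.hurwitzZetaOdd (a : UnitAddCircle) (s : ℂ) -
      ((a ^ (-s) / 2 : ℝ) : ℂ)) =ᶠ[nhdsWithin 1 (Set.Ioi 1)] (fun s : ℝ ↦ ∑' n : ℕ,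
      (((((n : ℝ) + 1 + a) ^ (-s) - ((n : ℝ) + 1 - a) ^ (-s)) / 2 : ℝ) : ℂ)) := by
    filter_upwards [self_mem_nhdsWithin] with s hs
    exact (hasSum_hurwitzZetaOdd_sub ha ha1 hs).tsum_eq.symm
  have h := tendsto_nhds_unique (lim2.congr' heq) lim1
  have hcot := cot_series_rep' hmem
  have hs : (∑' n : ℕ, (((((n : ℝ) + 1 + a) ^ (-1 : ℝ) -
      ((n : ℝ) + 1 - a) ^ (-1 : ℝ)) / 2 : ℝ) : ℂ)) =
      (∑' n : ℕ, (1 / ((a : ℂ) - (n + 1)) + 1 / ((a : ℂ) + (n + 1)))) / 2 := by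
    rw [← tsum_div_const]
    refine tsum_congr fun n ↦ ?_
    rw [Real.rpow_neg_one, Real.rpow_neg_one]
    push_cast
    rw [show (a : ℂ) - (n + 1) = -((n : ℂ) + 1 - a) by ring,
      show (a : ℂ) + (n + 1) = (n : ℂ) + 1 + a by ring, one_div, one_div, inv_neg]
    ring
  rw [hs, ← hcot, Real.rpow_neg_one] at h
  push_cast at h ⊢
  linear_combination h

theorem LFunction_one_eq_sum_cot {N : ℕ} [NeZero N] {χ : DirichletCharacter ℂ N} (hχ : χ.Odd)
    (hN : N ≠ 1) :
    χ.LFunction 1 = ((Real.pi / (2 * N) : ℝ) : ℂ) *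
      ∑ j : ZMod N, χ j * ((Real.cot (Real.pi * (j.val / N)) : ℝ) : ℂ) := by
  rw [DirichletCharacter.LFunction, ZMod.LFunction_def_odd hχ.to_fun, Finset.mul_sum,
    Finset.mul_sum]
  refine Finset.sum_congr rfl fun j _ ↦ ?_
  have hN0 : (0 : ℝ) < N := by exact_mod_cast NeZero.pos N
  have hNC : (N : ℂ) ≠ 0 := by exact_mod_cast hN0.ne'
  rcases eq_or_ne j 0 with rfl | hj
  -- The cotangent value requires `0 < a < 1`, so `j = 0` is separate; its term vanishes since `N ≠
  -- 1` makes `0` a nonunit.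
  · have : χ 0 = 0 := by
      have := Fact.mk (show 1 < N by have := NeZero.pos N; omega)
      exact χ.map_nonunit not_isUnit_zero
    simp [this]
  · have hv : 0 < j.val := Nat.pos_of_ne_zero (by simpa [ZMod.val_eq_zero] using hj)
    rw [ZMod.toAddCircle_apply, hurwitzZetaOdd_one (by positivity)
      (by rw [div_lt_one hN0]; exact_mod_cast ZMod.val_lt j)]
    rw [Complex.cpow_neg_one]
    push_cast
    field_simp

/-! ### Orthogonality for odd characters trivial on a subgroup. -/

theorem exists_dirichletCharacter_apply_ne_one {f : ℕ} [NeZero f] {K : Subgroup (ZMod f)ˣ}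
    {x : (ZMod f)ˣ} (hx : x ∉ K) :
    ∃ χ : DirichletCharacter ℂ f, (∀ k ∈ K, χ ((k : (ZMod f)ˣ) : ZMod f) = 1) ∧
      χ (x : ZMod f) ≠ 1 := by
  have : NeZero ((Monoid.exponent ((ZMod f)ˣ ⧸ K) : ℕ) : ℂ) :=
    ⟨Nat.cast_ne_zero.2 (Monoid.exponent_ne_zero_of_finite (G := (ZMod f)ˣ ⧸ K))⟩
  obtain ⟨φ, hφ⟩ := CommGroup.exists_apply_ne_one_of_hasEnoughRootsOfUnity
    ((ZMod f)ˣ ⧸ K) ℂ (a := (QuotientGroup.mk x : (ZMod f)ˣ ⧸ K))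
    (by rwa [Ne, QuotientGroup.eq_one_iff])
  refine ⟨MulChar.ofUnitHom (φ.comp (QuotientGroup.mk' K)), fun k hk ↦ ?_, ?_⟩
  · have : (QuotientGroup.mk k : (ZMod f)ˣ ⧸ K) = 1 := (QuotientGroup.eq_one_iff k).2 hk
    simp [this]
  · simpa [MulChar.ofUnitHom_coe] using hφ

theorem mem_oddCharactersTrivialOn {f : ℕ} [NeZero f] {H : Subgroup (ZMod f)ˣ}
    {χ : DirichletCharacter ℂ f} :
    χ ∈ oddCharactersTrivialOn f H ↔ χ.Odd ∧ ∀ h ∈ H, χ ((h : (ZMod f)ˣ) : ZMod f) = 1 := by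
  simp [oddCharactersTrivialOn]

theorem oddCharactersTrivialOn_nonempty {f : ℕ} [NeZero f] {H : Subgroup (ZMod f)ˣ}
    (hH : (-1 : (ZMod f)ˣ) ∉ H) : (oddCharactersTrivialOn f H).Nonempty := by
  obtain ⟨χ, h1, h2⟩ := exists_dirichletCharacter_apply_ne_one hH
  refine ⟨χ, mem_oddCharactersTrivialOn.2 ⟨?_, h1⟩⟩
  rcases χ.even_or_odd with h | h
  · exact absurd (by rw [Units.val_neg, Units.val_one]; exact h) h2
  · exact h

open Classical in
-- When neither `x` nor `-x` lies in `H`, some `ψ` trivial on `⟨H, -1⟩` has `ψ(x) ≠ 1`.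
-- Multiplication by `ψ` permutes the odd characters trivial on `H`, so the sum is fixed by
-- multiplication by `ψ(x)` and vanishes.
theorem sum_oddCharactersTrivialOn {f : ℕ} [NeZero f] {H : Subgroup (ZMod f)ˣ}
    (hH : (-1 : (ZMod f)ˣ) ∉ H) (x : (ZMod f)ˣ) :
    ∑ χ ∈ oddCharactersTrivialOn f H, χ (x : ZMod f) =
      ((oddCharactersTrivialOn f H).card : ℂ) *
        ((if x ∈ H then 1 else 0) - (if -x ∈ H then 1 else 0)) := by
  have hodd : ∀ χ ∈ oddCharactersTrivialOn f H, ∀ y : (ZMod f)ˣ,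
      χ ((-y : (ZMod f)ˣ) : ZMod f) = -χ (y : ZMod f) := fun χ hχ y ↦ by
    rw [Units.val_neg]
    exact (mem_oddCharactersTrivialOn.1 hχ).1.to_fun _
  by_cases hx : x ∈ H
  · have hx' : -x ∉ H := fun h ↦ hH (by simpa using H.mul_mem h (H.inv_mem hx))
    rw [if_pos hx, if_neg hx', Finset.sum_congr rfl
      fun χ hχ ↦ (mem_oddCharactersTrivialOn.1 hχ).2 x hx]
    simp
  by_cases hx' : -x ∈ H
  · rw [if_neg hx, if_pos hx', Finset.sum_congr rfl fun χ hχ ↦ by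
      rw [← neg_neg x, hodd χ hχ, (mem_oddCharactersTrivialOn.1 hχ).2 _ hx']]
    simp
  rw [if_neg hx, if_neg hx']
  have hK : x ∉ H ⊔ Subgroup.zpowers (-1) := by
    intro h
    obtain ⟨y, hy, z, hz, rfl⟩ := Subgroup.mem_sup.1 h
    obtain ⟨k, rfl⟩ := Subgroup.mem_zpowers_iff.1 hz
    rcases Int.even_or_odd k with hk | hk
    · rw [hk.neg_one_zpow, mul_one] at hx
      exact hx hy
    · rw [hk.neg_one_zpow] at hx'
      simp only [mul_neg, mul_one, neg_neg] at hx'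
      exact hx' hy
  obtain ⟨ψ, h1, h2⟩ := exists_dirichletCharacter_apply_ne_one hK
  have e : ψ (-1) = 1 := by
    simpa using h1 (-1) (Subgroup.mem_sup_right (Subgroup.mem_zpowers _))
  have hmem (χ : DirichletCharacter ℂ f) :
      ψ * χ ∈ oddCharactersTrivialOn f H ↔ χ ∈ oddCharactersTrivialOn f H := by
    rw [mem_oddCharactersTrivialOn, mem_oddCharactersTrivialOn]
    refine and_congr ?_ (forall₂_congr fun h hh ↦ ?_)
    · rw [DirichletCharacter.Odd, DirichletCharacter.Odd, MulChar.mul_apply, e, one_mul]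
    · rw [MulChar.mul_apply, h1 h (Subgroup.mem_sup_left hh), one_mul]
  have hS : ψ (x : ZMod f) * ∑ χ ∈ oddCharactersTrivialOn f H, χ (x : ZMod f) =
      ∑ χ ∈ oddCharactersTrivialOn f H, χ (x : ZMod f) := by
    rw [Finset.mul_sum]
    refine Finset.sum_equiv (Equiv.mulLeft ψ) (fun χ ↦ ?_) fun χ _ ↦ ?_
    · simp [hmem]
    · simp [MulChar.mul_apply]
  have := mul_right_eq_self₀.1 ((mul_comm _ _).trans hS)
  rw [this.resolve_left h2]
  simp

/-! ### The twisted mean as a sum of products of cotangents. -/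

theorem DirichletCharacter.conj_apply_unit {f : ℕ} [NeZero f] (χ : DirichletCharacter ℂ f)
    (u : (ZMod f)ˣ) :
    conj (χ (u : ZMod f)) = χ ((u⁻¹ : (ZMod f)ˣ) : ZMod f) := by
  rw [← Complex.inv_eq_conj (χ.unit_norm_eq_one u)]
  refine inv_eq_of_mul_eq_one_right ?_
  rw [← map_mul, ← Units.val_mul, mul_inv_cancel, Units.val_one, map_one]

/-- The value of `cot (π x / f)` at the representative of `x` of least absolute value. -/
noncomputable def cotResidue {f : ℕ} (x : ZMod f) : ℝ :=
  Real.cot (Real.pi * (x.valMinAbs / f))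

theorem Real.cot_add_int_mul_pi (x : ℝ) (n : ℤ) : Real.cot (x + n * Real.pi) = Real.cot x := by
  rw [Real.cot_eq_cos_div_sin, Real.cot_eq_cos_div_sin, Real.cos_add_int_mul_pi,
    Real.sin_add_int_mul_pi, mul_div_mul_left]
  exact zpow_ne_zero _ (by norm_num)

theorem cot_eq_cotResidue {f : ℕ} [NeZero f] (x : ZMod f) (n : ℤ) (h : (n : ZMod f) = x) :
    Real.cot (Real.pi * (n / f)) = cotResidue x := by
  have hf : (f : ℝ) ≠ 0 := by exact_mod_cast NeZero.ne f
  rw [← ZMod.coe_valMinAbs x] at h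
  obtain ⟨k, hk⟩ := (ZMod.intCast_eq_intCast_iff_dvd_sub _ _ _).1 h.symm
  have : (n : ℝ) = x.valMinAbs + f * k := by
    have : n = x.valMinAbs + f * k := by linarith
    exact_mod_cast this
  rw [cotResidue, this, add_div, mul_add, mul_div_cancel_left₀ _ hf, mul_comm _ (k : ℝ),
    Real.cot_add_int_mul_pi]

theorem cotResidue_neg {f : ℕ} [NeZero f] (x : ZMod f) : cotResidue (-x) = -cotResidue x := by
  rw [← cot_eq_cotResidue (-x) (-x.valMinAbs) (by simp), cotResidue, Int.cast_neg, neg_div,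
    mul_neg, Real.cot_eq_cos_div_sin, Real.cot_eq_cos_div_sin, Real.cos_neg, Real.sin_neg, div_neg]

theorem LFunction_one_eq_sum_cotResidue {f : ℕ} [NeZero f] {χ : DirichletCharacter ℂ f}
    (hχ : χ.Odd) (hf : f ≠ 1) :
    χ.LFunction 1 = ((Real.pi / (2 * f) : ℝ) : ℂ) *
      ∑ u : (ZMod f)ˣ, χ (u : ZMod f) * ((cotResidue (u : ZMod f) : ℝ) : ℂ) := by
  rw [LFunction_one_eq_sum_cot hχ hf]
  congr 1
  refine ((Finset.sum_of_injOn (fun u : (ZMod f)ˣ ↦ (u : ZMod f)) Units.val_injective.injOn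
    (fun _ _ ↦ Finset.mem_coe.2 (Finset.mem_univ _)) ?_ ?_).symm)
  · intro x _ hx
    rw [χ.map_nonunit, zero_mul]
    rintro ⟨u, rfl⟩
    exact hx ⟨u, by simp, rfl⟩
  · intro u _
    rw [← cot_eq_cotResidue (u : ZMod f) ((u : ZMod f).val : ℤ) (by simp)]
    simp

/-- Orthogonality leaves the pairs with `u₁a = ±h u₂b`. Since the cotangent is odd, both signs
contribute equally, which turns `π²/(4f²)` into `π²/(2f²)`. -/
theorem twistedMean_eq_sum_cotResidue {f : ℕ} [NeZero f] (hf : f ≠ 1) {H : Subgroup (ZMod f)ˣ}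
    [Fintype H] (hH : (-1 : (ZMod f)ˣ) ∉ H) {q₁ q₂ : ℕ} (u₁ u₂ : (ZMod f)ˣ)
    (h₁ : (u₁ : ZMod f) = q₁) (h₂ : (u₂ : ZMod f) = q₂) :
    twistedMean q₁ q₂ f H = ((Real.pi ^ 2 / (2 * f ^ 2) * ∑ h : H, ∑ b : (ZMod f)ˣ,
      cotResidue ((h.1 * u₂ * b : (ZMod f)ˣ) : ZMod f) *
        cotResidue ((u₁ * b : (ZMod f)ˣ) : ZMod f) : ℝ) : ℂ) := by
  classical
  set X := oddCharactersTrivialOn f H with hX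
  have hcard : (X.card : ℂ) ≠ 0 := by
    exact_mod_cast (Finset.card_pos.2 (oddCharactersTrivialOn_nonempty hH)).ne'
  set c : (ZMod f)ˣ → ℝ := fun u ↦ cotResidue (u : ZMod f) with hc
  have cneg (u : (ZMod f)ˣ) : c (-u) = - c u := by
    simp only [hc, Units.val_neg, cotResidue_neg]
  have e1 : ∀ χ ∈ X, χ (q₁ : ZMod f) * conj (χ (q₂ : ZMod f)) * ((‖χ.LFunction 1‖ ^ 2 : ℝ) : ℂ) =
      ((Real.pi / (2 * f) : ℝ) : ℂ) ^ 2 * ∑ a : (ZMod f)ˣ, ∑ b : (ZMod f)ˣ,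
        ((c a * c b : ℝ) : ℂ) * χ ((u₁ * a * (u₂ * b)⁻¹ : (ZMod f)ˣ) : ZMod f) := by
    intro χ hχ
    rw [← Complex.normSq_eq_norm_sq, Complex.normSq_eq_conj_mul_self, ← h₁, ← h₂,
      LFunction_one_eq_sum_cotResidue (mem_oddCharactersTrivialOn.1 hχ).1 hf, map_mul, map_sum,
      Complex.conj_ofReal]
    have : ∀ A B P S T : ℂ, A * B * (P * S * (P * T)) = P ^ 2 * (A * B * (T * S)) := by
      intros; ring
    rw [this, Finset.sum_mul_sum, Finset.mul_sum]
    congr 1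
    refine Finset.sum_congr rfl fun a _ ↦ ?_
    rw [Finset.mul_sum]
    refine Finset.sum_congr rfl fun b _ ↦ ?_
    rw [map_mul, Complex.conj_ofReal, χ.conj_apply_unit, χ.conj_apply_unit, mul_inv,
      Units.val_mul, Units.val_mul, Units.val_mul, map_mul, map_mul, map_mul]
    push_cast
    ring
  have e2 : ∑ χ ∈ X, χ (q₁ : ZMod f) * conj (χ (q₂ : ZMod f)) *
      ((‖χ.LFunction 1‖ ^ 2 : ℝ) : ℂ) = ((Real.pi / (2 * f) : ℝ) : ℂ) ^ 2 * (X.card *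
      ((∑ b : (ZMod f)ˣ, ∑ a : (ZMod f)ˣ, c a * c b * ((if u₁ * a * (u₂ * b)⁻¹ ∈ H then 1 else 0) -
        (if -(u₁ * a * (u₂ * b)⁻¹) ∈ H then 1 else 0)) : ℝ) : ℂ)) := by
    rw [Finset.sum_congr rfl e1, ← Finset.mul_sum, Finset.sum_comm,
      Finset.sum_congr rfl fun a _ ↦ Finset.sum_comm, Finset.sum_comm]
    congr 1
    simp only [Complex.ofReal_sum, Finset.mul_sum]
    refine Finset.sum_congr rfl fun b _ ↦ Finset.sum_congr rfl fun a _ ↦ ?_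
    rw [← Finset.mul_sum, sum_oddCharactersTrivialOn hH, ← hX]
    split_ifs <;> push_cast <;> ring
  have e3 : (∑ b : (ZMod f)ˣ, ∑ a : (ZMod f)ˣ, c a * c b *
      ((if u₁ * a * (u₂ * b)⁻¹ ∈ H then (1 : ℝ) else 0) -
        (if -(u₁ * a * (u₂ * b)⁻¹) ∈ H then 1 else 0))) =
      2 * ∑ h : H, ∑ b : (ZMod f)ˣ, c (h.1 * u₂ * b) * c (u₁ * b) := by
    have r1 (b : (ZMod f)ˣ) : ∑ a : (ZMod f)ˣ, c a * c b *
        ((if u₁ * a * (u₂ * b)⁻¹ ∈ H then (1 : ℝ) else 0) -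
          (if -(u₁ * a * (u₂ * b)⁻¹) ∈ H then 1 else 0)) =
        2 * ∑ h : H, c (h.1 * u₂ * (u₁⁻¹ * b)) * c b := by
      rw [← Equiv.sum_comp ((Equiv.mulRight (u₁⁻¹ * (u₂ * b))))]
      have s1 (x : (ZMod f)ˣ) : u₁ * (x * (u₁⁻¹ * (u₂ * b))) * (u₂ * b)⁻¹ = x := by
        rw [mul_left_comm u₁, mul_inv_cancel_left, mul_inv_cancel_right]
      simp only [Equiv.coe_mulRight, s1, mul_sub, Finset.sum_sub_distrib]
      have s2 : ∑ x : (ZMod f)ˣ, c (x * (u₁⁻¹ * (u₂ * b))) * c b * (if -x ∈ H then (1 : ℝ) else 0) =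
          - ∑ x : (ZMod f)ˣ, c (x * (u₁⁻¹ * (u₂ * b))) * c b * (if x ∈ H then (1 : ℝ) else 0) := by
        rw [← Equiv.sum_comp (Equiv.neg (ZMod f)ˣ), ← Finset.sum_neg_distrib]
        simp only [Equiv.neg_apply, neg_neg, neg_mul, cneg]
      rw [s2, sub_neg_eq_add, ← two_mul]
      congr 1
      simp only [mul_ite, mul_one, mul_zero]
      rw [← Finset.sum_filter]
      rw [← Finset.sum_subtype (Finset.univ.filter (· ∈ H)) (by simp)
        (fun h ↦ c (h * u₂ * (u₁⁻¹ * b)) * c b)]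
      refine Finset.sum_congr rfl fun x _ ↦ ?_
      rw [mul_left_comm u₁⁻¹, mul_assoc]
    rw [Finset.sum_congr rfl fun b _ ↦ r1 b, ← Finset.mul_sum, Finset.sum_comm]
    congr 1
    refine Finset.sum_congr rfl fun h _ ↦ ?_
    -- The substitution `b ↦ u₁b` removes the inverse of `u₁`.
    rw [← Equiv.sum_comp (Equiv.mulLeft u₁)]
    simp
  change _ = ((Real.pi ^ 2 / (2 * f ^ 2) *
    ∑ h : H, ∑ b : (ZMod f)ˣ, c (h.1 * u₂ * b) * c (u₁ * b) : ℝ) : ℂ)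
  rw [twistedMean, ← hX, e2, e3]
  push_cast
  field_simp

/-! ### Reciprocal sums over separated integer points. -/

/-- Cut each sign quadrant into boxes of side `m`. Separation allows at most one point per box, and
`hmin` leaves the corner box empty. The box weights factor into a square; `4` counts the quadrants
and `-1` removes the corner box. -/
theorem sum_one_div_mul_le_of_separated {ι : Type*} [Fintype ι] (u v : ι → ℤ) {m P : ℕ}
    (hm : 0 < m) (hu : ∀ i, (u i).natAbs ≤ P) (hv : ∀ i, (v i).natAbs ≤ P)
    (hu0 : ∀ i, u i ≠ 0) (hv0 : ∀ i, v i ≠ 0)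
    (hmin : ∀ i, m ≤ (u i).natAbs ∨ m ≤ (v i).natAbs)
    (hsep : ∀ i j, i ≠ j → m ≤ (u i - u j).natAbs ∨ m ≤ (v i - v j).natAbs) :
    ∑ i, 1 / (((u i).natAbs : ℝ) * (v i).natAbs) ≤
      4 * ((1 + (∑ n ∈ Finset.range P, 1 / ((n : ℝ) + 1)) / m) ^ 2 - 1) := by
  classical
  have hmR : (0 : ℝ) < m := by exact_mod_cast hm
  -- `w j` bounds `1/n` for `n ≥ 1` with `n / m = j`; for `j = 0` only `1/n ≤ 1` is used.
  set w : ℕ → ℝ := fun j ↦ if j = 0 then 1 else 1 / (m * (j : ℝ)) with hw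
  have hw0 (j : ℕ) : 0 ≤ w j := by
    simp only [hw]; split_ifs <;> positivity
  have hle (n : ℕ) (hn : 0 < n) : 1 / (n : ℝ) ≤ w (n / m) := by
    have hnR : (1 : ℝ) ≤ n := by exact_mod_cast hn
    simp only [hw]
    split_ifs with h
    · rw [div_le_one (by positivity)]; exact hnR
    · have : (m : ℝ) * ((n / m : ℕ) : ℝ) ≤ n := by exact_mod_cast Nat.mul_div_le n m
      have h1 : (0 : ℝ) < ((n / m : ℕ) : ℝ) := by exact_mod_cast Nat.pos_of_ne_zero h
      exact one_div_le_one_div_of_le (by positivity) this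
  set F : ι → (ℕ × ℕ) × (Bool × Bool) := fun i ↦
    (((u i).natAbs / m, (v i).natAbs / m), (decide (0 < u i), decide (0 < v i))) with hF
  have hclose (a b : ℤ) (ha : a ≠ 0) (hb : b ≠ 0) (h : a.natAbs / m = b.natAbs / m)
      (hs : decide (0 < a) = decide (0 < b)) : (a - b).natAbs < m := by
    have hs' : 0 < a ↔ 0 < b := by simpa using hs
    have h1 := Nat.div_add_mod a.natAbs m
    have h2 := Nat.div_add_mod b.natAbs m
    have h3 := Nat.mod_lt a.natAbs hm
    have h4 := Nat.mod_lt b.natAbs hm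
    rw [h] at h1
    generalize m * (b.natAbs / m) = k at *
    omega
  have hinj : Function.Injective F := by
    intro i j hij
    by_contra hne
    simp only [hF, Prod.mk.injEq] at hij
    have h1 := hclose _ _ (hu0 i) (hu0 j) hij.1.1 hij.2.1
    have h2 := hclose _ _ (hv0 i) (hv0 j) hij.1.2 hij.2.2
    rcases hsep i j hne with h | h <;> omega
  set R := Finset.range (P + 1) with hR
  set S : Finset ((ℕ × ℕ) × (Bool × Bool)) := ((R ×ˢ R).erase (0, 0)) ×ˢ Finset.univ with hS
  have hW : ∑ j ∈ R, w j = 1 + (∑ n ∈ Finset.range P, 1 / ((n : ℝ) + 1)) / m := by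
    rw [hR, Finset.sum_range_succ', add_comm, Finset.sum_div]
    congr 1
    refine Finset.sum_congr rfl fun n _ ↦ ?_
    simp only [hw, Nat.add_eq_zero_iff, one_ne_zero, and_false, if_false]
    push_cast
    field_simp
  calc ∑ i, 1 / (((u i).natAbs : ℝ) * (v i).natAbs)
      ≤ ∑ i, w (F i).1.1 * w (F i).1.2 := by
        refine Finset.sum_le_sum fun i _ ↦ ?_
        rw [← one_div_mul_one_div]
        exact mul_le_mul (hle _ (Int.natAbs_pos.2 (hu0 i))) (hle _ (Int.natAbs_pos.2 (hv0 i)))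
          (by positivity) (hw0 _)
    _ = ∑ e ∈ Finset.univ.image F, w e.1.1 * w e.1.2 := by
        rw [Finset.sum_image hinj.injOn]
    _ ≤ ∑ e ∈ S, w e.1.1 * w e.1.2 := by
        refine Finset.sum_le_sum_of_subset_of_nonneg ?_ fun _ _ _ ↦ mul_nonneg (hw0 _) (hw0 _)
        intro e he
        obtain ⟨i, -, rfl⟩ := Finset.mem_image.1 he
        have h1 := (Nat.div_le_self (u i).natAbs m).trans (hu i)
        have h2 := (Nat.div_le_self (v i).natAbs m).trans (hv i)
        simp only [hS, hF, hR, Finset.mem_product, Finset.mem_erase, Finset.mem_univ, and_true,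
          Finset.mem_range, Ne, Prod.mk.injEq, Nat.div_eq_zero_iff]
        refine ⟨fun h ↦ ?_, by omega, by omega⟩
        rcases hmin i with h' | h' <;> omega
    _ = 4 * ((1 + (∑ n ∈ Finset.range P, 1 / ((n : ℝ) + 1)) / m) ^ 2 - 1) := by
        rw [hS, Finset.sum_product]
        simp only [Finset.sum_const, Finset.card_univ, Fintype.card_prod, Fintype.card_bool,
          ← Finset.smul_sum]
        rw [← hW, sq, Finset.sum_mul_sum, ← Finset.sum_product',
          ← Finset.add_sum_erase (R ×ˢ R) (fun e : ℕ × ℕ ↦ w e.1 * w e.2) (a := (0, 0)) (by simp [hR])]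
        simp [hw]

/-! ### Lower bounds from cyclotomic polynomials. -/

/-- The value is the homogeneous form `y^φ(n) Φ_n(x/y)`. It is nonzero because `Φ_n` is positive on
the reals for `n > 2`, and the size bound holds because all roots lie on the unit circle. -/
theorem Polynomial.eval_scaleRoots_cyclotomic_bound {n : ℕ} (hn : 2 < n) (x y : ℤ) (hy : y ≠ 0) :
    eval x ((cyclotomic n ℤ).scaleRoots y) ≠ 0 ∧
      (eval x ((cyclotomic n ℤ).scaleRoots y)).natAbs ≤ (x.natAbs + y.natAbs) ^ n.totient := by
  have hyR : (y : ℝ) ≠ 0 := by exact_mod_cast hy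
  have key : ((eval x ((cyclotomic n ℤ).scaleRoots y) : ℤ) : ℝ) =
      (y : ℝ) ^ n.totient * eval ((x : ℝ) / y) (cyclotomic n ℝ) := by
    have := scaleRoots_eval₂_mul (p := cyclotomic n ℤ) (Int.castRingHom ℝ) ((x : ℝ) / y) y
    rw [← map_cyclotomic_int n ℝ, eval_map, ← natDegree_cyclotomic n ℤ]
    simp only [eq_intCast, mul_div_cancel₀ _ hyR] at this
    rw [← this]
    simp
  have hnorm : |eval ((x : ℝ) / y) (cyclotomic n ℝ)| ≤ (|(x : ℝ) / y| + 1) ^ n.totient := by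
    have h1 : ((eval ((x : ℝ) / y) (cyclotomic n ℝ) : ℝ) : ℂ) =
        eval (((x : ℝ) / y : ℝ) : ℂ) (cyclotomic n ℂ) := by
      rw [← map_cyclotomic n Complex.ofRealHom, eval_map, ← Complex.ofRealHom_eq_coe,
        ← Complex.ofRealHom_eq_coe, eval₂_at_apply]
    have hp := Complex.isPrimitiveRoot_exp n (by omega)
    rw [← Real.norm_eq_abs, ← Complex.norm_real, h1, cyclotomic_eq_prod_X_sub_primitiveRoots hp,
      eval_prod, norm_prod, ← hp.card_primitiveRoots]
    refine (Finset.prod_le_prod (fun _ _ ↦ norm_nonneg _) fun μ hμ ↦ ?_).trans_eq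
      (Finset.prod_const _)
    have hμ1 : ‖μ‖ = 1 := ((mem_primitiveRoots (by omega)).1 hμ).norm'_eq_one (by omega)
    rw [eval_sub, eval_X, eval_C, ← Real.norm_eq_abs, ← Complex.norm_real, ← hμ1]
    exact norm_sub_le _ _
  constructor
  · intro h
    rw [h, Int.cast_zero, eq_comm, mul_eq_zero] at key
    rcases key with h | h
    · exact pow_ne_zero _ hyR h
    · exact (cyclotomic_pos hn _).ne' h
  · have : (((eval x ((cyclotomic n ℤ).scaleRoots y)).natAbs : ℕ) : ℝ) ≤
        (((x.natAbs + y.natAbs) ^ n.totient : ℕ) : ℝ) := by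
      rw [Nat.cast_natAbs, Int.cast_abs, key, abs_mul, abs_pow]
      calc _ ≤ |(y : ℝ)| ^ n.totient * (|(x : ℝ) / y| + 1) ^ n.totient := by gcongr
        _ = _ := by
          have := abs_pos.2 hyR
          rw [← mul_pow, abs_div]
          push_cast [Nat.cast_natAbs]
          congr 1
          field_simp
    exact_mod_cast this

/-- As `h` is a root of `Φ_n` mod `p`, with `n` its order, `p` divides the nonzero integer `y^φ(n)
Φ_n(x/y)`. -/
theorem ZMod.le_add_pow_totient_orderOf {p : ℕ} [Fact p.Prime] {h : ZMod p} (hh : 2 < orderOf h)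
    {x y : ℤ} (hy : y ≠ 0) (hxy : (x : ZMod p) = h * y) :
    p ≤ (x.natAbs + y.natAbs) ^ (orderOf h).totient := by
  obtain ⟨h1, h2⟩ := Polynomial.eval_scaleRoots_cyclotomic_bound hh x y hy
  refine (Nat.le_of_dvd (Int.natAbs_pos.2 h1) ?_).trans h2
  rw [← Int.natCast_dvd, ← ZMod.intCast_zmod_eq_zero_iff_dvd]
  have := Polynomial.scaleRoots_eval₂_mul (p := Polynomial.cyclotomic (orderOf h) ℤ)
    (Int.castRingHom (ZMod p)) h y
  have hroot := (IsPrimitiveRoot.orderOf h).isRoot_cyclotomic (by omega)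
  rw [Polynomial.IsRoot, ← Polynomial.map_cyclotomic_int, Polynomial.eval_map] at hroot
  rw [hroot, mul_zero, eq_intCast, mul_comm, ← hxy] at this
  rw [← this, Polynomial.eval₂_eq_eval_map, Polynomial.eval_intCast_map]
  simp

/-! ### Cotangent estimates and sums over least absolute residues. -/

theorem Real.abs_cot_sub_inv_le_one {y : ℝ} (hy : y ≠ 0) (hy2 : |y| ≤ Real.pi / 2) :
    |Real.cot y| ≤ |y|⁻¹ ∧ |Real.cot y - y⁻¹| ≤ 1 := by
  wlog hpos : 0 < y generalizing y
  · have := this (neg_ne_zero.2 hy) (by rwa [abs_neg])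
      (by have := lt_of_le_of_ne (not_lt.1 hpos) hy; linarith)
    have e : Real.cot (-y) = - Real.cot y := by
      rw [Real.cot_eq_cos_div_sin, Real.cot_eq_cos_div_sin, Real.cos_neg, Real.sin_neg, div_neg]
    rw [e, abs_neg, abs_neg, inv_neg, ← neg_sub', abs_neg] at this
    exact this
  rw [abs_of_pos hpos] at hy2 ⊢
  have hpi := Real.pi_pos
  have hsin : 0 < Real.sin y := Real.sin_pos_of_pos_of_lt_pi hpos (by linarith)
  have hcos : 0 ≤ Real.cos y := Real.cos_nonneg_of_neg_pi_div_two_le_of_le (by linarith) hy2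
  rw [Real.cot_eq_cos_div_sin]
  have h1 : Real.cos y / Real.sin y ≤ y⁻¹ := by
    rcases hy2.eq_or_lt with h | h
    · rw [h, Real.cos_pi_div_two, zero_div]; positivity
    · have h2 := (Real.lt_tan hpos h).le
      have hc : 0 < Real.cos y := Real.cos_pos_of_mem_Ioo ⟨by linarith, h⟩
      rw [Real.tan_eq_sin_div_cos, le_div_iff₀ hc] at h2
      rw [div_le_iff₀ hsin, inv_mul_eq_div, le_div_iff₀ hpos]
      linarith
  have h0 : 0 ≤ Real.cos y / Real.sin y := by positivity
  refine ⟨by rwa [abs_of_nonneg h0], ?_⟩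
  rw [abs_sub_comm, abs_of_nonneg (by linarith), sub_le_iff_le_add, inv_le_comm₀ hpos (by positivity)]
  rw [inv_le_iff_one_le_mul₀ (by positivity)]
  -- This is `1/y - cot y ≤ 1` with denominators cleared.
  have : Real.sin y ≤ y * (Real.sin y + Real.cos y) := by
    rcases le_or_gt 1 y with h | h
    · nlinarith [mul_nonneg hpos.le hcos]
    · have hs := (Real.sin_lt hpos).le
      have hc := Real.one_sub_sq_div_two_le_cos (x := y)
      nlinarith
  calc 1 = Real.sin y / Real.sin y := (div_self hsin.ne').symm
    _ ≤ y * (Real.sin y + Real.cos y) / Real.sin y := by gcongr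
    _ = _ := by field_simp

theorem Real.sum_range_inv_le_one_add_log (n : ℕ) :
    ∑ i ∈ Finset.range n, 1 / ((i : ℝ) + 1) ≤ 1 + Real.log n := by
  have := harmonic_le_one_add_log n
  simpa [harmonic] using this

theorem Real.one_le_log_natCast {p : ℕ} (hp : 3 ≤ p) : 1 ≤ Real.log p := by
  have h3 : (3 : ℝ) ≤ p := by exact_mod_cast hp
  rw [Real.le_log_iff_exp_le (by linarith)]
  linarith [Real.exp_one_lt_d9]

/-- The classes of `n` and `p - n` share their least absolute value, so each of `1, …, k` occurs
twice. -/
theorem ZMod.sum_units_natAbs_valMinAbs {p k : ℕ} [Fact p.Prime] (hk : p = 2 * k + 1) (g : ℕ → ℝ) :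
    ∑ b : (ZMod p)ˣ, g (b : ZMod p).valMinAbs.natAbs = 2 * ∑ n ∈ Finset.range k, g (n + 1) := by
  have h1 : ∑ b : (ZMod p)ˣ, g (b : ZMod p).valMinAbs.natAbs =
      ∑ n ∈ Finset.range (k + k), g (min (n + 1) (p - (n + 1))) := by
    have hval (b : (ZMod p)ˣ) : 0 < (b : ZMod p).val :=
      Nat.pos_of_ne_zero fun h ↦ b.ne_zero ((ZMod.val_eq_zero _).1 h)
    refine Finset.sum_bij (fun b _ ↦ (b : ZMod p).val - 1) (fun b _ ↦ ?_) (fun a _ b _ h ↦ ?_)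
      (fun n hn ↦ ?_) fun b _ ↦ ?_
    · have := ZMod.val_lt (b : ZMod p)
      have := hval b
      rw [Finset.mem_range]
      omega
    · have := hval a
      have := hval b
      exact Units.ext (ZMod.val_injective p (by omega))
    · rw [Finset.mem_range] at hn
      have hlt : n + 1 < p := by omega
      have hv : ((n + 1 : ℕ) : ZMod p).val = n + 1 := ZMod.val_natCast_of_lt hlt
      refine ⟨Units.mk0 ((n + 1 : ℕ) : ZMod p) ?_, Finset.mem_univ _, ?_⟩
      · intro h
        rw [h, ZMod.val_zero] at hv
        omega
      · rw [Units.val_mk0, hv, Nat.add_sub_cancel]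
    · rw [ZMod.valMinAbs_natAbs_eq_min, Nat.sub_add_cancel (hval b)]
  rw [h1, Finset.sum_range_add, two_mul]
  congr 1
  · refine Finset.sum_congr rfl fun n hn ↦ ?_
    rw [Finset.mem_range] at hn
    congr 1
    omega
  · rw [← Finset.sum_range_reflect]
    refine Finset.sum_congr rfl fun n hn ↦ ?_
    rw [Finset.mem_range] at hn
    congr 1
    omega

theorem Nat.Prime.exists_eq_two_mul_add_one {p : ℕ} (hp : p.Prime) (hp3 : 3 ≤ p) :
    ∃ k, p = 2 * k + 1 :=
  hp.odd_of_ne_two (by omega)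

theorem ZMod.sum_units_one_div_natAbs_valMinAbs_le {p : ℕ} [hp : Fact p.Prime] (hp3 : 3 ≤ p)
    (u : (ZMod p)ˣ) :
    ∑ b : (ZMod p)ˣ, 1 / (((u * b : (ZMod p)ˣ) : ZMod p).valMinAbs.natAbs : ℝ) ≤
      4 * Real.log p := by
  obtain ⟨k, hk⟩ := hp.out.exists_eq_two_mul_add_one hp3
  refine (Equiv.sum_comp (Equiv.mulLeft u)
    (fun b : (ZMod p)ˣ ↦ 1 / ((b : ZMod p).valMinAbs.natAbs : ℝ))).trans_le ?_
  rw [ZMod.sum_units_natAbs_valMinAbs hk (fun n ↦ 1 / (n : ℝ))]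
  have h1 := Real.sum_range_inv_le_one_add_log k
  have h2 := Real.one_le_log_natCast hp3
  have h3 : Real.log k ≤ Real.log p :=
    Real.log_le_log (by exact_mod_cast (show 0 < k by omega)) (by exact_mod_cast (by omega))
  push_cast
  linarith

theorem ZMod.abs_sum_units_inv_sq_sub_le {p : ℕ} [hp : Fact p.Prime] (hp3 : 3 ≤ p) :
    |∑ b : (ZMod p)ˣ, 1 / ((b : ZMod p).valMinAbs.natAbs : ℝ) ^ 2 - Real.pi ^ 2 / 3| ≤
      8 / (p : ℝ) := by
  obtain ⟨k, hk⟩ := hp.out.exists_eq_two_mul_add_one hp3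
  rw [ZMod.sum_units_natAbs_valMinAbs hk (fun n ↦ 1 / (n : ℝ) ^ 2)]
  have hz := hasSum_zeta_two
  have e : ∑ n ∈ Finset.range k, 1 / ((n + 1 : ℕ) : ℝ) ^ 2 =
      ∑ n ∈ Finset.range (k + 1), 1 / (n : ℝ) ^ 2 := by
    rw [Finset.sum_range_succ']
    simp
  have lo : ∑ n ∈ Finset.range (k + 1), 1 / (n : ℝ) ^ 2 ≤ Real.pi ^ 2 / 6 :=
    sum_le_hasSum _ (fun _ _ ↦ by positivity) hz
  have hi : Real.pi ^ 2 / 6 ≤ ∑ n ∈ Finset.range (k + 1), 1 / (n : ℝ) ^ 2 + 2 / ((k : ℝ) + 1) := by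
    rw [← hz.tsum_eq]
    refine Real.tsum_le_of_sum_range_le (fun _ ↦ by positivity) fun N ↦ ?_
    have := sum_Ioo_inv_sq_le (α := ℝ) k N
    calc ∑ i ∈ Finset.range N, 1 / (i : ℝ) ^ 2
        ≤ ∑ i ∈ Finset.range (k + 1) ∪ Finset.Ioo k N, 1 / (i : ℝ) ^ 2 := by
          refine Finset.sum_le_sum_of_subset_of_nonneg (fun i hi ↦ ?_) fun _ _ _ ↦ by positivity
          simp only [Finset.mem_union, Finset.mem_range, Finset.mem_Ioo] at hi ⊢
          omega
      _ ≤ ∑ i ∈ Finset.range (k + 1), 1 / (i : ℝ) ^ 2 + ∑ i ∈ Finset.Ioo k N, 1 / (i : ℝ) ^ 2 := by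
          rw [← Finset.sum_union_inter]
          exact le_add_of_nonneg_right (Finset.sum_nonneg fun _ _ ↦ by positivity)
      _ ≤ _ := by
          gcongr
          simpa only [one_div] using this
  have h8 : 2 / ((k : ℝ) + 1) ≤ 4 / p := by
    rw [hk, div_le_div_iff₀ (by positivity) (by positivity)]
    push_cast
    linarith
  have h84 : (8 : ℝ) / p = 2 * (4 / p) := by ring
  rw [e, abs_le, h84]
  constructor <;> linarith [show (0 : ℝ) ≤ 4 / p by positivity]

theorem ZMod.natAbs_valMinAbs_intCast_le {p : ℕ} [NeZero p] (n : ℤ) :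
    (n : ZMod p).valMinAbs.natAbs ≤ n.natAbs :=
  ZMod.natAbs_min_of_le_div_two p _ _ (by simp) (ZMod.natAbs_valMinAbs_le _)

theorem ZMod.valMinAbs_ne_zero {p : ℕ} [Fact p.Prime] (u : (ZMod p)ˣ) :
    (u : ZMod p).valMinAbs ≠ 0 := by
  rw [Ne, ZMod.valMinAbs_eq_zero]
  exact u.ne_zero

theorem cotResidue_bounds {p : ℕ} [hp : Fact p.Prime] (u : (ZMod p)ˣ) :
    |cotResidue (u : ZMod p)| ≤ p / (Real.pi * ((u : ZMod p).valMinAbs.natAbs : ℝ)) ∧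
      |cotResidue (u : ZMod p) - p / (Real.pi * ((u : ZMod p).valMinAbs : ℝ))| ≤ 1 := by
  have hp0 : (0 : ℝ) < p := by exact_mod_cast hp.out.pos
  have h0 : ((u : ZMod p).valMinAbs : ℝ) ≠ 0 := by exact_mod_cast ZMod.valMinAbs_ne_zero u
  have h2 : |((u : ZMod p).valMinAbs : ℝ)| ≤ p / 2 := by
    have h := ZMod.natAbs_valMinAbs_le (u : ZMod p)
    rw [← Int.cast_abs, ← Nat.cast_natAbs]
    have : 2 * (u : ZMod p).valMinAbs.natAbs ≤ p := by omega
    have : (2 : ℝ) * (u : ZMod p).valMinAbs.natAbs ≤ p := by exact_mod_cast this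
    linarith
  have key := Real.abs_cot_sub_inv_le_one
    (y := Real.pi * (((u : ZMod p).valMinAbs : ℝ) / p)) (by have := Real.pi_pos; positivity) (by
      rw [abs_mul, abs_div, abs_of_pos Real.pi_pos, abs_of_pos hp0]
      calc Real.pi * (|((u : ZMod p).valMinAbs : ℝ)| / p) ≤ Real.pi * (p / 2 / p) := by gcongr
        _ = _ := by field_simp)
  have e1 : (Real.pi * (((u : ZMod p).valMinAbs : ℝ) / p))⁻¹ =
      p / (Real.pi * ((u : ZMod p).valMinAbs : ℝ)) := by
    have := Real.pi_pos
    field_simp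
  rw [e1, ← abs_inv, e1, abs_div, abs_mul, abs_of_pos hp0, abs_of_pos Real.pi_pos, ← Int.cast_abs,
    ← Nat.cast_natAbs] at key
  exact key

/-! ### The terms with `h ≠ 1`. -/

/-- Modulo `p` the points `(Ax, Bx)` are additive in `x`, so `hmin` applied to `x - y` yields the
separation: reducing a difference of residues mod `p` cannot increase its absolute value. -/
theorem ZMod.sum_units_one_div_mul_le {p m : ℕ} [hp : Fact p.Prime] (hp3 : 3 ≤ p) (hm : 0 < m)
    (A B : (ZMod p)ˣ) (hmin : ∀ x : (ZMod p)ˣ,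
      m ≤ ((A * x : (ZMod p)ˣ) : ZMod p).valMinAbs.natAbs ∨
      m ≤ ((B * x : (ZMod p)ˣ) : ZMod p).valMinAbs.natAbs) :
    ∑ x : (ZMod p)ˣ, 1 / ((((A * x : (ZMod p)ˣ) : ZMod p).valMinAbs.natAbs : ℝ) *
      ((B * x : (ZMod p)ˣ) : ZMod p).valMinAbs.natAbs) ≤ 32 * Real.log p ^ 2 / m := by
  have hsep (C x y : (ZMod p)ˣ) (z : (ZMod p)ˣ) (hz : (z : ZMod p) = (x : ZMod p) - y) :
      ((C * z : (ZMod p)ˣ) : ZMod p).valMinAbs.natAbs ≤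
      (((C * x : (ZMod p)ˣ) : ZMod p).valMinAbs - ((C * y : (ZMod p)ˣ) : ZMod p).valMinAbs).natAbs := by
    refine le_trans (le_of_eq ?_) (ZMod.natAbs_valMinAbs_intCast_le (p := p) _)
    congr 2
    simp [hz, mul_sub]
  have h := sum_one_div_mul_le_of_separated
    (fun x : (ZMod p)ˣ ↦ ((A * x : (ZMod p)ˣ) : ZMod p).valMinAbs)
    (fun x : (ZMod p)ˣ ↦ ((B * x : (ZMod p)ˣ) : ZMod p).valMinAbs) (P := p / 2) hm
    (fun _ ↦ ZMod.natAbs_valMinAbs_le _) (fun _ ↦ ZMod.natAbs_valMinAbs_le _)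
    (fun _ ↦ ZMod.valMinAbs_ne_zero _) (fun _ ↦ ZMod.valMinAbs_ne_zero _) hmin (fun x y hxy ↦ by
      have hne : (x : ZMod p) - y ≠ 0 := fun h ↦ hxy (Units.ext (sub_eq_zero.1 h))
      refine (hmin (Units.mk0 _ hne)).imp (fun h ↦ h.trans (hsep A x y _ rfl))
        fun h ↦ h.trans (hsep B x y _ rfl))
  refine h.trans ?_
  set L := ∑ n ∈ Finset.range (p / 2), 1 / ((n : ℝ) + 1) with hL
  have hl := Real.one_le_log_natCast hp3
  have hL0 : 0 ≤ L := Finset.sum_nonneg fun _ _ ↦ by positivity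
  have hL2 : L ≤ 2 * Real.log p := by
    have h1 := Real.sum_range_inv_le_one_add_log (p / 2)
    have h3 : Real.log (p / 2 : ℕ) ≤ Real.log p :=
      Real.log_le_log (by exact_mod_cast (show 0 < p / 2 by omega))
        (by exact_mod_cast (by omega))
    linarith
  have hmR : (1 : ℝ) ≤ m := by exact_mod_cast hm
  have e : 4 * ((1 + L / m) ^ 2 - 1) = 4 * (2 * L + L ^ 2 / m) / m := by
    field_simp
    ring
  rw [e]
  have : L ^ 2 / m ≤ L ^ 2 := div_le_self (by positivity) hmR
  refine div_le_div_of_nonneg_right ?_ (by positivity)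
  nlinarith

theorem ZMod.abs_sum_cotResidue_le {p d : ℕ} [hp : Fact p.Prime] (hp3 : 3 ≤ p) {q₁ q₂ : ℕ}
    (hq₁ : 1 ≤ q₁) (hq₂ : 1 ≤ q₂) (u₁ u₂ h : (ZMod p)ˣ)
    (h₁ : (u₁ : ZMod p) = q₁) (h₂ : (u₂ : ZMod p) = q₂) (hh : 2 < orderOf h) (hd : 0 < d)
    (hhd : orderOf h ∣ d) :
    |∑ b : (ZMod p)ˣ, cotResidue ((h * u₂ * b : (ZMod p)ˣ) : ZMod p) *
        cotResidue ((u₁ * b : (ZMod p)ˣ) : ZMod p)| ≤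
      32 * (q₁ + q₂) * (p ^ 2 * Real.log p ^ 2 * (p : ℝ) ^ (-(1 / (d.totient : ℝ)))) := by
  have hp0 : (0 : ℝ) < p := by exact_mod_cast hp.out.pos
  have hp1 : (1 : ℝ) ≤ p := by exact_mod_cast hp.out.one_lt.le
  have hQ : (0 : ℝ) < (q₁ : ℝ) + q₂ := by
    have : (1 : ℝ) ≤ q₁ := by exact_mod_cast hq₁
    positivity
  set P : ℝ := (p : ℝ) ^ (1 / (d.totient : ℝ)) with hP
  have hP0 : 0 < P := Real.rpow_pos_of_pos hp0 _
  -- The ceiling gives both `(q₁+q₂)(m-1) < P`, which contradicts the cyclotomic bound if both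
  -- residues are below `m`, and `m ≥ P/(q₁+q₂)`, used for the saving.
  set m := ⌈P / (q₁ + q₂)⌉₊ with hm
  have hm0 : 0 < m := Nat.ceil_pos.2 (by positivity)
  have hmP : P / (q₁ + q₂) ≤ m := Nat.le_ceil _
  have hmP' : ((m - 1 : ℕ) : ℝ) < P / (q₁ + q₂) := by
    rw [← Nat.lt_ceil]
    omega
  have hmin : ∀ x : (ZMod p)ˣ,
      m ≤ ((h * u₂ * x : (ZMod p)ˣ) : ZMod p).valMinAbs.natAbs ∨
      m ≤ ((u₁ * x : (ZMod p)ˣ) : ZMod p).valMinAbs.natAbs := by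
    intro x
    by_contra! hcon
    obtain ⟨c1, c2⟩ := hcon
    set U := ((h * u₂ * x : (ZMod p)ˣ) : ZMod p).valMinAbs with hU
    set V := ((u₁ * x : (ZMod p)ˣ) : ZMod p).valMinAbs with hV
    have hV0 : V ≠ 0 := ZMod.valMinAbs_ne_zero _
    have hord : orderOf (h : ZMod p) = orderOf h := orderOf_units
    have key := ZMod.le_add_pow_totient_orderOf (p := p) (h := (h : ZMod p)) (by rwa [hord])
      (x := q₁ * U) (y := q₂ * V) (mul_ne_zero (by omega) hV0) (by
        rw [Int.cast_mul, Int.cast_mul, hU, hV, ZMod.coe_valMinAbs, ZMod.coe_valMinAbs]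
        push_cast
        rw [h₁, h₂]
        ring)
    rw [hord, Int.natAbs_mul, Int.natAbs_mul, Int.natAbs_natCast, Int.natAbs_natCast] at key
    have b1 : q₁ * U.natAbs + q₂ * V.natAbs ≤ (q₁ + q₂) * (m - 1) := by
      rw [add_mul]
      gcongr <;> omega
    have b2 : p ≤ ((q₁ + q₂) * (m - 1)) ^ (orderOf h).totient :=
      key.trans (Nat.pow_le_pow_left b1 _)
    have b3 : (p : ℝ) ≤ (((q₁ : ℝ) + q₂) * (m - 1 : ℕ)) ^ (orderOf h).totient := by
      exact_mod_cast b2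
    have b4 : ((q₁ : ℝ) + q₂) * (m - 1 : ℕ) < P := by
      rw [lt_div_iff₀ hQ] at hmP'
      linarith
    have ht : 0 < (orderOf h).totient := Nat.totient_pos.2 (by omega)
    have htd : (orderOf h).totient ≤ d.totient :=
      Nat.le_of_dvd (Nat.totient_pos.2 hd) (Nat.totient_dvd_of_dvd hhd)
    have b5 : (p : ℝ) < P ^ (orderOf h).totient :=
      b3.trans_lt (pow_lt_pow_left₀ b4 (by positivity) ht.ne')
    have b6 : P ^ (orderOf h).totient ≤ p := by
      have hd0 : (0 : ℝ) < d.totient := by exact_mod_cast Nat.totient_pos.2 hd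
      rw [hP, ← Real.rpow_natCast, ← Real.rpow_mul hp0.le]
      refine (Real.rpow_le_rpow_of_exponent_le hp1 ?_).trans_eq (Real.rpow_one _)
      rw [one_div_mul_eq_div, div_le_one hd0]
      exact_mod_cast htd
    exact absurd (b5.trans_le b6) (lt_irrefl _)
  have hsum := ZMod.sum_units_one_div_mul_le hp3 hm0 (h * u₂) u₁ hmin
  calc |∑ b : (ZMod p)ˣ, cotResidue ((h * u₂ * b : (ZMod p)ˣ) : ZMod p) *
        cotResidue ((u₁ * b : (ZMod p)ˣ) : ZMod p)|
      ≤ ∑ b : (ZMod p)ˣ, p ^ 2 * (1 / ((((h * u₂ * b : (ZMod p)ˣ) : ZMod p).valMinAbs.natAbs : ℝ) *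
          ((u₁ * b : (ZMod p)ˣ) : ZMod p).valMinAbs.natAbs)) := by
        refine (Finset.abs_sum_le_sum_abs _ _).trans (Finset.sum_le_sum fun b _ ↦ ?_)
        have hU : (0 : ℝ) < ((h * u₂ * b : (ZMod p)ˣ) : ZMod p).valMinAbs.natAbs := by
          exact_mod_cast Int.natAbs_pos.2 (ZMod.valMinAbs_ne_zero _)
        have hV : (0 : ℝ) < ((u₁ * b : (ZMod p)ˣ) : ZMod p).valMinAbs.natAbs := by
          exact_mod_cast Int.natAbs_pos.2 (ZMod.valMinAbs_ne_zero _)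
        have c1 := (cotResidue_bounds (h * u₂ * b)).1
        have c2 := (cotResidue_bounds (u₁ * b)).1
        have hpi : (1 : ℝ) ≤ Real.pi := by linarith [Real.pi_gt_three]
        have c3 : ∀ {x : ℝ}, 0 < x → (p : ℝ) / (Real.pi * x) ≤ p / x := fun hx ↦ by
          gcongr
          exact le_mul_of_one_le_left hx.le hpi
        rw [abs_mul]
        refine (mul_le_mul (c1.trans (c3 hU)) (c2.trans (c3 hV)) (abs_nonneg _)
          (by positivity)).trans_eq ?_
        field_simp
    _ ≤ p ^ 2 * (32 * Real.log p ^ 2 / m) := by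
        rw [← Finset.mul_sum]
        gcongr
    _ ≤ p ^ 2 * (32 * Real.log p ^ 2 / (P / (q₁ + q₂))) := by gcongr
    _ = _ := by
        rw [Real.rpow_neg hp0.le, ← hP]
        field_simp

/-! ### The term `h = 1`. -/

theorem ZMod.valMinAbs_intCast_of_two_mul_natAbs_lt {p : ℕ} [NeZero p] {n : ℤ}
    (h : 2 * n.natAbs < p) : (n : ZMod p).valMinAbs = n :=
  (ZMod.valMinAbs_spec _ _).2 ⟨rfl, by constructor <;> omega⟩

/-- Coprimality gives `U = q₂t` with `t ≡ b`; as `|t| ≤ |U| < p/2`, `t` is the least absolute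
residue of `b`. -/
theorem ZMod.valMinAbs_mul_of_natCast_mul_eq {p : ℕ} [hp : Fact p.Prime] (hp3 : 3 ≤ p)
    {q₁ q₂ : ℕ} (hq₂ : 1 ≤ q₂) (hq : q₁.Coprime q₂) (u₁ u₂ b : (ZMod p)ˣ)
    (h₂ : (u₂ : ZMod p) = q₂)
    (heq : q₁ * ((u₂ * b : (ZMod p)ˣ) : ZMod p).valMinAbs =
      q₂ * ((u₁ * b : (ZMod p)ˣ) : ZMod p).valMinAbs) :
    ((u₂ * b : (ZMod p)ˣ) : ZMod p).valMinAbs = q₂ * (b : ZMod p).valMinAbs ∧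
      ((u₁ * b : (ZMod p)ˣ) : ZMod p).valMinAbs = q₁ * (b : ZMod p).valMinAbs := by
  obtain ⟨k, hk⟩ := hp.out.exists_eq_two_mul_add_one hp3
  have hbd := ZMod.natAbs_valMinAbs_le ((u₂ * b : (ZMod p)ˣ) : ZMod p)
  have hU := ZMod.coe_valMinAbs ((u₂ * b : (ZMod p)ˣ) : ZMod p)
  set U := ((u₂ * b : (ZMod p)ˣ) : ZMod p).valMinAbs
  set V := ((u₁ * b : (ZMod p)ˣ) : ZMod p).valMinAbs
  have hq20 : (q₂ : ℤ) ≠ 0 := by omega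
  obtain ⟨t, ht⟩ : (q₂ : ℤ) ∣ U :=
    (Nat.isCoprime_iff_coprime.2 hq.symm).dvd_of_dvd_mul_left ⟨V, heq⟩
  have hbt : ((t : ℤ) : ZMod p) = b := by
    rw [ht, Int.cast_mul, Int.cast_natCast, ← h₂, Units.val_mul] at hU
    exact u₂.isUnit.mul_left_cancel hU
  have htU : t.natAbs ≤ U.natAbs := by
    rw [ht, Int.natAbs_mul, Int.natAbs_natCast]
    exact Nat.le_mul_of_pos_left _ hq₂
  have hT : (b : ZMod p).valMinAbs = t := by
    rw [← hbt]
    exact ZMod.valMinAbs_intCast_of_two_mul_natAbs_lt (by omega)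
  rw [hT]
  refine ⟨ht, mul_left_cancel₀ hq20 ?_⟩
  rw [← heq, ht]
  ring

/-- Both products are `q₁q₂b` mod `p`, so unequal ones differ by at least `p`. If the residue of `b`
were small, multiplication by `q₁` and `q₂` would not wrap around and the products would agree. -/
theorem ZMod.le_of_natCast_mul_ne {p : ℕ} [hp : Fact p.Prime] {q₁ q₂ : ℕ} (u₁ u₂ b : (ZMod p)ˣ)
    (h₁ : (u₁ : ZMod p) = q₁) (h₂ : (u₂ : ZMod p) = q₂)
    (hne : q₁ * ((u₂ * b : (ZMod p)ˣ) : ZMod p).valMinAbs ≠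
      q₂ * ((u₁ * b : (ZMod p)ˣ) : ZMod p).valMinAbs) :
    p ≤ q₁ * ((u₂ * b : (ZMod p)ˣ) : ZMod p).valMinAbs.natAbs +
        q₂ * ((u₁ * b : (ZMod p)ˣ) : ZMod p).valMinAbs.natAbs ∧
      p ≤ 2 * (q₁ + q₂) * (b : ZMod p).valMinAbs.natAbs := by
  have hU := ZMod.coe_valMinAbs ((u₂ * b : (ZMod p)ˣ) : ZMod p)
  have hV := ZMod.coe_valMinAbs ((u₁ * b : (ZMod p)ˣ) : ZMod p)
  constructor
  · set U := ((u₂ * b : (ZMod p)ˣ) : ZMod p).valMinAbs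
    set V := ((u₁ * b : (ZMod p)ˣ) : ZMod p).valMinAbs
    have hdvd : (p : ℤ) ∣ q₁ * U - q₂ * V := by
      rw [← ZMod.intCast_zmod_eq_zero_iff_dvd]
      push_cast
      rw [hU, hV, ← h₁, ← h₂, Units.val_mul, Units.val_mul]
      ring
    have h1 : p ≤ (q₁ * U - q₂ * V).natAbs :=
      Nat.le_of_dvd (Int.natAbs_pos.2 (sub_ne_zero.2 hne)) (Int.natCast_dvd.1 hdvd)
    have h2 := Int.natAbs_sub_le (q₁ * U) (q₂ * V)
    rw [Int.natAbs_mul, Int.natAbs_mul, Int.natAbs_natCast, Int.natAbs_natCast] at h2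
    exact h1.trans h2
  · by_contra! hlt
    have key (q : ℕ) (u : (ZMod p)ˣ) (hu : (u : ZMod p) = q) (hq : q ≤ q₁ + q₂) :
        ((u * b : (ZMod p)ˣ) : ZMod p).valMinAbs = q * (b : ZMod p).valMinAbs := by
      rw [← ZMod.valMinAbs_intCast_of_two_mul_natAbs_lt (p := p)
        (n := q * (b : ZMod p).valMinAbs)]
      · rw [Int.cast_mul, ZMod.coe_valMinAbs, Int.cast_natCast, Units.val_mul, hu]
      · rw [Int.natAbs_mul, Int.natAbs_natCast, ← mul_assoc]
        exact lt_of_le_of_lt (by gcongr) hlt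
    rw [key q₂ u₂ h₂ (by omega), key q₁ u₁ h₁ (by omega)] at hne
    exact hne (by ring)

/-- When `q₁U = q₂V`, replacing one cotangent at a time costs at most `1` times the other factor.
Otherwise both terms are small separately: the inequalities of `ZMod.le_of_natCast_mul_ne` trade a
factor `p` for `|U|`, `|V|` or `|T|`, cancelling a denominator. -/
theorem ZMod.abs_cotResidue_mul_sub_le {p : ℕ} [hp : Fact p.Prime] (hp3 : 3 ≤ p) {q₁ q₂ : ℕ}
    (hq₁ : 1 ≤ q₁) (hq₂ : 1 ≤ q₂) (hq : q₁.Coprime q₂) (u₁ u₂ b : (ZMod p)ˣ)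
    (h₁ : (u₁ : ZMod p) = q₁) (h₂ : (u₂ : ZMod p) = q₂) :
    |cotResidue ((u₂ * b : (ZMod p)ˣ) : ZMod p) * cotResidue ((u₁ * b : (ZMod p)ˣ) : ZMod p) -
        p ^ 2 / (Real.pi ^ 2 * q₁ * q₂) * (1 / ((b : ZMod p).valMinAbs.natAbs : ℝ) ^ 2)| ≤
      2 * (q₁ + q₂) * p * (1 / (((u₂ * b : (ZMod p)ˣ) : ZMod p).valMinAbs.natAbs : ℝ) +
        1 / (((u₁ * b : (ZMod p)ˣ) : ZMod p).valMinAbs.natAbs : ℝ) +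
        1 / ((b : ZMod p).valMinAbs.natAbs : ℝ)) := by
  have hp0 : (0 : ℝ) < p := by exact_mod_cast hp.out.pos
  have hq1R : (1 : ℝ) ≤ q₁ := by exact_mod_cast hq₁
  have hq2R : (1 : ℝ) ≤ q₂ := by exact_mod_cast hq₂
  have hpi : (1 : ℝ) ≤ Real.pi := by linarith [Real.pi_gt_three]
  have hpi0 := Real.pi_pos
  obtain ⟨cU, cU'⟩ := cotResidue_bounds (u₂ * b)
  obtain ⟨cV, cV'⟩ := cotResidue_bounds (u₁ * b)
  have hU0 := ZMod.valMinAbs_ne_zero (u₂ * b)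
  have hV0 := ZMod.valMinAbs_ne_zero (u₁ * b)
  have hT0 := ZMod.valMinAbs_ne_zero b
  have hgood := ZMod.valMinAbs_mul_of_natCast_mul_eq hp3 hq₂ hq u₁ u₂ b h₂
  have hbad := ZMod.le_of_natCast_mul_ne u₁ u₂ b h₁ h₂
  generalize cotResidue ((u₂ * b : (ZMod p)ˣ) : ZMod p) = x at *
  generalize cotResidue ((u₁ * b : (ZMod p)ˣ) : ZMod p) = y at *
  generalize ((u₂ * b : (ZMod p)ˣ) : ZMod p).valMinAbs = U at *
  generalize ((u₁ * b : (ZMod p)ˣ) : ZMod p).valMinAbs = V at *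
  generalize (b : ZMod p).valMinAbs = T at *
  have aU : (0 : ℝ) < U.natAbs := by exact_mod_cast Int.natAbs_pos.2 hU0
  have aV : (0 : ℝ) < V.natAbs := by exact_mod_cast Int.natAbs_pos.2 hV0
  have aT : (0 : ℝ) < T.natAbs := by exact_mod_cast Int.natAbs_pos.2 hT0
  have c3 : ∀ {z : ℝ}, 0 < z → (p : ℝ) / (Real.pi * z) ≤ p * (1 / z) := fun hz ↦ by
    rw [mul_one_div]
    gcongr
    exact le_mul_of_one_le_left hz.le hpi
  have cU1 := cU.trans (c3 aU)
  have cV1 := cV.trans (c3 aV)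
  have iT : 0 < 1 / (T.natAbs : ℝ) := by positivity
  by_cases heq : (q₁ : ℤ) * U = q₂ * V
  · obtain ⟨gU, gV⟩ := hgood heq
    have hTR : (T : ℝ) ≠ 0 := by exact_mod_cast hT0
    have gUR : (U : ℝ) = q₂ * T := by exact_mod_cast gU
    have gVR : (V : ℝ) = q₁ * T := by exact_mod_cast gV
    have hTsq : (T.natAbs : ℝ) ^ 2 = (T : ℝ) ^ 2 := by rw [Nat.cast_natAbs, Int.cast_abs, sq_abs]
    have e : x * y - p ^ 2 / (Real.pi ^ 2 * q₁ * q₂) * (1 / (T.natAbs : ℝ) ^ 2) =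
        (x - p / (Real.pi * U)) * y + p / (Real.pi * U) * (y - p / (Real.pi * V)) := by
      rw [hTsq, gUR, gVR]
      field_simp
      ring
    have hpU : |p / (Real.pi * (U : ℝ))| ≤ p * (1 / (U.natAbs : ℝ)) := by
      rw [abs_div, abs_mul, abs_of_pos hp0, abs_of_pos hpi0, ← Int.cast_abs, ← Nat.cast_natAbs]
      exact c3 aU
    rw [e]
    calc _ ≤ |x - p / (Real.pi * U)| * |y| + |p / (Real.pi * (U : ℝ))| * |y - p / (Real.pi * V)| := by
          rw [← abs_mul, ← abs_mul]
          exact abs_add_le _ _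
      _ ≤ 1 * (p * (1 / V.natAbs)) + p * (1 / U.natAbs) * 1 := by gcongr
      _ = 1 * p * (1 / (U.natAbs : ℝ) + 1 / V.natAbs + 0) := by ring
      _ ≤ _ := by
          gcongr
          linarith
  · obtain ⟨b1, b2⟩ := hbad heq
    have b1R : (p : ℝ) ≤ q₁ * U.natAbs + q₂ * V.natAbs := by exact_mod_cast b1
    have b2R : (p : ℝ) ≤ 2 * (q₁ + q₂) * T.natAbs := by exact_mod_cast b2
    have hxy : |x * y| ≤ p * (q₁ * (1 / (V.natAbs : ℝ)) + q₂ * (1 / U.natAbs)) := by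
      rw [abs_mul]
      calc |x| * |y| ≤ p * (1 / U.natAbs) * (p * (1 / V.natAbs)) := by gcongr
        _ = p * (p * (1 / U.natAbs * (1 / V.natAbs))) := by ring
        _ ≤ p * ((q₁ * U.natAbs + q₂ * V.natAbs) * (1 / U.natAbs * (1 / V.natAbs))) := by gcongr
        _ = _ := by field_simp
    have hT : |p ^ 2 / (Real.pi ^ 2 * q₁ * q₂) * (1 / (T.natAbs : ℝ) ^ 2)| ≤
        2 * (q₁ + q₂) * p * (1 / (T.natAbs : ℝ)) := by
      rw [abs_of_nonneg (by positivity)]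
      have h1 : (p : ℝ) ^ 2 / (Real.pi ^ 2 * q₁ * q₂) ≤ p ^ 2 :=
        div_le_self (by positivity)
          (one_le_mul_of_one_le_of_one_le (one_le_mul_of_one_le_of_one_le (one_le_pow₀ hpi) hq1R) hq2R)
      calc _ ≤ (p : ℝ) ^ 2 * (1 / (T.natAbs : ℝ) ^ 2) := by gcongr
        _ = p * p * (1 / (T.natAbs : ℝ) ^ 2) := by ring
        _ ≤ 2 * (q₁ + q₂) * T.natAbs * p * (1 / (T.natAbs : ℝ) ^ 2) := by gcongr
        _ = _ := by field_simp
    calc _ ≤ |x * y| + |p ^ 2 / (Real.pi ^ 2 * q₁ * q₂) * (1 / (T.natAbs : ℝ) ^ 2)| := abs_sub _ _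
      _ ≤ p * (q₁ * (1 / V.natAbs) + q₂ * (1 / U.natAbs)) + 2 * (q₁ + q₂) * p * (1 / T.natAbs) :=
          add_le_add hxy hT
      _ ≤ p * (2 * (q₁ + q₂) * (1 / V.natAbs) + 2 * (q₁ + q₂) * (1 / U.natAbs)) +
          2 * (q₁ + q₂) * p * (1 / (T.natAbs : ℝ)) := by
          gcongr <;> linarith
      _ = _ := by ring

theorem ZMod.abs_sum_cotResidue_sub_le {p : ℕ} [hp : Fact p.Prime] (hp3 : 3 ≤ p) {q₁ q₂ : ℕ}
    (hq₁ : 1 ≤ q₁) (hq₂ : 1 ≤ q₂) (hq : q₁.Coprime q₂) (u₁ u₂ : (ZMod p)ˣ)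
    (h₁ : (u₁ : ZMod p) = q₁) (h₂ : (u₂ : ZMod p) = q₂) :
    |∑ b : (ZMod p)ˣ, cotResidue ((u₂ * b : (ZMod p)ˣ) : ZMod p) *
        cotResidue ((u₁ * b : (ZMod p)ˣ) : ZMod p) - p ^ 2 / (3 * q₁ * q₂)| ≤
      32 * (q₁ + q₂) * (p * Real.log p) := by
  have hp0 : (0 : ℝ) < p := by exact_mod_cast hp.out.pos
  have hq1R : (1 : ℝ) ≤ q₁ := by exact_mod_cast hq₁
  have hq2R : (1 : ℝ) ≤ q₂ := by exact_mod_cast hq₂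
  have hpi : (1 : ℝ) ≤ Real.pi := by linarith [Real.pi_gt_three]
  have hpi0 := Real.pi_pos
  have hl := Real.one_le_log_natCast hp3
  set K : ℝ := p ^ 2 / (Real.pi ^ 2 * q₁ * q₂) with hK
  have hK0 : 0 ≤ K := by positivity
  have hKp : K ≤ p ^ 2 := div_le_self (by positivity)
    (one_le_mul_of_one_le_of_one_le (one_le_mul_of_one_le_of_one_le (one_le_pow₀ hpi) hq1R) hq2R)
  set S := ∑ b : (ZMod p)ˣ, cotResidue ((u₂ * b : (ZMod p)ˣ) : ZMod p) *
        cotResidue ((u₁ * b : (ZMod p)ˣ) : ZMod p) with hS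
  set Z := ∑ b : (ZMod p)ˣ, 1 / ((b : ZMod p).valMinAbs.natAbs : ℝ) ^ 2 with hZ
  -- `π²/3 = 2ζ(2)` is the limit of `Z`, each absolute value being taken twice.
  have e : (p : ℝ) ^ 2 / (3 * q₁ * q₂) = K * (Real.pi ^ 2 / 3) := by
    rw [hK]
    field_simp
  have s1 : |S - K * Z| ≤ 2 * (q₁ + q₂) * p * (4 * Real.log p + 4 * Real.log p + 4 * Real.log p) := by
    rw [hS, hZ, Finset.mul_sum, ← Finset.sum_sub_distrib]
    refine (Finset.abs_sum_le_sum_abs _ _).trans ((Finset.sum_le_sum fun b _ ↦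
      ZMod.abs_cotResidue_mul_sub_le hp3 hq₁ hq₂ hq u₁ u₂ b h₁ h₂).trans ?_)
    rw [← Finset.mul_sum, Finset.sum_add_distrib, Finset.sum_add_distrib]
    have h3 := ZMod.sum_units_one_div_natAbs_valMinAbs_le hp3 (1 : (ZMod p)ˣ)
    simp only [one_mul] at h3
    gcongr
    · exact ZMod.sum_units_one_div_natAbs_valMinAbs_le hp3 u₂
    · exact ZMod.sum_units_one_div_natAbs_valMinAbs_le hp3 u₁
  have s2 : |K * Z - K * (Real.pi ^ 2 / 3)| ≤ 8 * (p : ℝ) := by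
    rw [← mul_sub, abs_mul, abs_of_nonneg hK0]
    calc K * |Z - Real.pi ^ 2 / 3| ≤ p ^ 2 * (8 / (p : ℝ)) := by
          gcongr
          exact ZMod.abs_sum_units_inv_sq_sub_le hp3
      _ = _ := by field_simp
  rw [e]
  have s3 : 8 * (p : ℝ) ≤ 8 * (q₁ + q₂) * (p * Real.log p) := by
    have h1 : (p : ℝ) ≤ p * Real.log p := le_mul_of_one_le_right hp0.le hl
    nlinarith
  calc _ ≤ |S - K * Z| + |K * Z - K * (Real.pi ^ 2 / 3)| := abs_sub_le _ _ _
    _ ≤ 2 * (q₁ + q₂) * p * (4 * Real.log p + 4 * Real.log p + 4 * Real.log p) +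
        8 * (q₁ + q₂) * (p * Real.log p) := add_le_add s1 (s2.trans s3)
    _ = _ := by ring

/-! ### Assembling the estimates. -/

theorem neg_one_notMem_of_odd_card {p : ℕ} [Fact p.Prime] (hp3 : 3 ≤ p) {H : Subgroup (ZMod p)ˣ}
    (hH : Odd (Nat.card H)) : (-1 : (ZMod p)ˣ) ∉ H := by
  intro h
  have h1 : orderOf (-1 : (ZMod p)ˣ) = 2 := by
    rw [← orderOf_units, Units.val_neg, Units.val_one, orderOf_neg_one, ZMod.ringChar_zmod_n,
      if_neg (by omega)]
  have h2 := Subgroup.orderOf_dvd_natCard H h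
  rw [h1] at h2
  exact (Nat.not_even_iff_odd.2 hH) (even_iff_two_dvd.2 h2)

theorem Real.one_div_le_rpow_neg_one_div_totient {p d : ℕ} (hp : 1 ≤ p) (hd : 0 < d) :
    1 / (p : ℝ) ≤ (p : ℝ) ^ (-(1 / (d.totient : ℝ))) := by
  rw [one_div (p : ℝ), ← Real.rpow_neg_one]
  refine Real.rpow_le_rpow_of_exponent_le (by exact_mod_cast hp) (neg_le_neg ?_)
  have : (1 : ℝ) ≤ d.totient := by exact_mod_cast Nat.totient_pos.2 hd
  exact div_le_one_of_le₀ this (by positivity)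

theorem norm_twistedMean_sub_le_of_coprime_of_not_dvd {p : ℕ} [hp : Fact p.Prime] (hp3 : 3 ≤ p)
    {q₁ q₂ : ℕ} (hq₁ : 1 ≤ q₁) (hq₂ : 1 ≤ q₂) (hq : q₁.Coprime q₂) (hpq : ¬ p ∣ q₁ * q₂)
    (H : Subgroup (ZMod p)ˣ) (hH : Odd (Nat.card H)) :
    ‖twistedMean q₁ q₂ p H - ((Real.pi ^ 2 / (6 * (q₁ : ℝ) * (q₂ : ℝ)) : ℝ) : ℂ)‖ ≤
      160 * (q₁ + q₂) * ((Nat.card H : ℝ) * Real.log (p : ℝ) ^ 2 *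
        (p : ℝ) ^ (-(1 / (Nat.totient (Nat.card H) : ℝ)))) := by
  classical
  have hp0 : (0 : ℝ) < p := by exact_mod_cast hp.out.pos
  have hq1R : (1 : ℝ) ≤ q₁ := by exact_mod_cast hq₁
  have hq2R : (1 : ℝ) ≤ q₂ := by exact_mod_cast hq₂
  have hl := Real.one_le_log_natCast hp3
  have ndvd {q : ℕ} (h : ¬ p ∣ q) : (q : ZMod p) ≠ 0 := by
    rwa [Ne, ZMod.natCast_eq_zero_iff]
  set u₁ : (ZMod p)ˣ := Units.mk0 (q₁ : ZMod p) (ndvd fun h ↦ hpq (h.mul_right _))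
  set u₂ : (ZMod p)ˣ := Units.mk0 (q₂ : ZMod p) (ndvd fun h ↦ hpq (h.mul_left _))
  have h₁ : (u₁ : ZMod p) = q₁ := rfl
  have h₂ : (u₂ : ZMod p) = q₂ := rfl
  set d := Nat.card H with hd
  have hd0 : 0 < d := hH.pos
  set R : ℝ := (p : ℝ) ^ (-(1 / (d.totient : ℝ))) with hR
  have hRp : 1 / (p : ℝ) ≤ R := Real.one_div_le_rpow_neg_one_div_totient (by omega) hd0
  rw [twistedMean_eq_sum_cotResidue (by omega) (neg_one_notMem_of_odd_card hp3 hH) u₁ u₂ h₁ h₂,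
    ← Complex.ofReal_sub, Complex.norm_real, Real.norm_eq_abs]
  set S : H → ℝ := fun h ↦ ∑ b : (ZMod p)ˣ, cotResidue ((h.1 * u₂ * b : (ZMod p)ˣ) : ZMod p) *
        cotResidue ((u₁ * b : (ZMod p)ˣ) : ZMod p) with hS
  set B : ℝ := 32 * (q₁ + q₂) * (p ^ 2 * Real.log p ^ 2 * R) with hB
  have hR0 : 0 < R := Real.rpow_pos_of_pos hp0 _
  have hbound (h : H) : |S h - if h = 1 then (p : ℝ) ^ 2 / (3 * q₁ * q₂) else 0| ≤ B := by
    split_ifs with h1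
    · subst h1
      have := ZMod.abs_sum_cotResidue_sub_le hp3 hq₁ hq₂ hq u₁ u₂ h₁ h₂
      simp only [hS, OneMemClass.coe_one, one_mul]
      refine this.trans ?_
      rw [hB]
      refine mul_le_mul_of_nonneg_left ?_ (by positivity)
      -- The diagonal error fits the common bound because `1/p ≤ p^(-1/φ(d))`.
      calc (p : ℝ) * Real.log p = p ^ 2 * Real.log p * (1 / p) := by field_simp
        _ ≤ p ^ 2 * Real.log p ^ 2 * R := by
            gcongr
            exact le_self_pow₀ hl two_ne_zero
    · rw [sub_zero]
      have hdvd : orderOf (h : (ZMod p)ˣ) ∣ d := Subgroup.orderOf_dvd_natCard H h.2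
      have hne1 : orderOf (h : (ZMod p)ˣ) ≠ 1 := by
        rw [Ne, orderOf_eq_one_iff]
        exact fun hh ↦ h1 (Subtype.ext hh)
      have hodd : Odd (orderOf (h : (ZMod p)ˣ)) := hH.of_dvd_nat hdvd
      refine ZMod.abs_sum_cotResidue_le hp3 hq₁ hq₂ u₁ u₂ h h₁ h₂ ?_ hd0 hdvd
      obtain ⟨k, hk⟩ := hodd
      omega
  have hsum : |∑ h : H, S h - (p : ℝ) ^ 2 / (3 * q₁ * q₂)| ≤ d * B := by
    have e : ∑ h : H, S h - (p : ℝ) ^ 2 / (3 * q₁ * q₂) =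
        ∑ h : H, (S h - if h = 1 then (p : ℝ) ^ 2 / (3 * q₁ * q₂) else 0) := by
      rw [Finset.sum_sub_distrib, Finset.sum_ite_eq' Finset.univ (1 : H)]
      simp
    rw [e]
    refine (Finset.abs_sum_le_sum_abs _ _).trans ((Finset.sum_le_sum fun h _ ↦ hbound h).trans_eq ?_)
    rw [Finset.sum_const, Finset.card_univ, nsmul_eq_mul, hd, Nat.card_eq_fintype_card]
  have e : Real.pi ^ 2 / (2 * (p : ℝ) ^ 2) * ∑ h : H, S h - Real.pi ^ 2 / (6 * q₁ * q₂) =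
      Real.pi ^ 2 / (2 * (p : ℝ) ^ 2) * (∑ h : H, S h - (p : ℝ) ^ 2 / (3 * q₁ * q₂)) := by
    field_simp
    ring
  have hpi2 : Real.pi ^ 2 ≤ 10 := by
    have := Real.pi_lt_d2
    nlinarith [Real.pi_pos]
  rw [e, abs_mul, abs_of_nonneg (by positivity)]
  -- The constant is `160 = (10/2) · 32`, using `π² ≤ 10`.
  calc _ ≤ 10 / (2 * (p : ℝ) ^ 2) * (d * B) := by gcongr
    _ = _ := by
      rw [hB]
      field_simp
      ring

theorem twistedMean_eq_zero_of_dvd {p q₁ q₂ : ℕ} [hp : Fact p.Prime] (hpq : p ∣ q₁ * q₂)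
    (H : Subgroup (ZMod p)ˣ) : twistedMean q₁ q₂ p H = 0 := by
  rw [twistedMean, Finset.sum_eq_zero, mul_zero]
  intro χ _
  have h0 : χ (0 : ZMod p) = 0 := χ.map_nonunit not_isUnit_zero
  rcases hp.out.dvd_mul.1 hpq with h | h <;>
    rw [(ZMod.natCast_eq_zero_iff _ _).2 h, h0] <;> simp

/-- Here the mean is zero, and `p ≤ q₁q₂` with `p · p^(-1/φ(d)) ≥ 1` keeps the right side at least
`2`, above `π²/6`. `A` stands for the gcd factor. -/
theorem norm_twistedMean_sub_le_of_dvd {p q₁ q₂ : ℕ} [hp : Fact p.Prime] (hp3 : 3 ≤ p)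
    (hq₁ : 1 ≤ q₁) (hq₂ : 1 ≤ q₂) (hpq : p ∣ q₁ * q₂)
    (H : Subgroup (ZMod p)ˣ) (hH : Odd (Nat.card H)) {A : ℝ} (hA : 0 ≤ A) (hA1 : A ≤ 1) :
    ‖twistedMean q₁ q₂ p H - ((Real.pi ^ 2 / 6 * A : ℝ) : ℂ)‖ ≤
      2 * (q₁ * q₂) * ((Nat.card H : ℝ) * Real.log (p : ℝ) ^ 2 *
        (p : ℝ) ^ (-(1 / (Nat.totient (Nat.card H) : ℝ)))) := by
  have hp0 : (0 : ℝ) < p := by exact_mod_cast hp.out.pos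
  have hl := Real.one_le_log_natCast hp3
  have hd : (1 : ℝ) ≤ Nat.card H := by exact_mod_cast hH.pos
  have hRp := Real.one_div_le_rpow_neg_one_div_totient (p := p) (by omega) hH.pos
  have hpi2 : Real.pi ^ 2 / 6 ≤ 2 := by
    have := Real.pi_lt_d2
    nlinarith [Real.pi_pos]
  have hle : (p : ℝ) ≤ q₁ * q₂ := by exact_mod_cast Nat.le_of_dvd (Nat.mul_pos hq₁ hq₂) hpq
  rw [twistedMean_eq_zero_of_dvd hpq, zero_sub, norm_neg, Complex.norm_real, Real.norm_eq_abs,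
    abs_of_nonneg (by positivity)]
  calc Real.pi ^ 2 / 6 * A ≤ 2 * 1 := by gcongr
    _ = 2 * p * (1 * 1 ^ 2 * (1 / p)) := by field_simp
    _ ≤ _ := by gcongr

theorem twistedMean_mul_left {p g : ℕ} [Fact p.Prime] (hg : ¬ p ∣ g) (q₁ q₂ : ℕ)
    (H : Subgroup (ZMod p)ˣ) : twistedMean (g * q₁) (g * q₂) p H = twistedMean q₁ q₂ p H := by
  rw [twistedMean, twistedMean]
  congr 1
  refine Finset.sum_congr rfl fun χ _ ↦ ?_
  have hu : IsUnit (g : ZMod p) := by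
    rw [isUnit_iff_ne_zero, Ne, ZMod.natCast_eq_zero_iff]
    exact hg
  have h1 : χ (g : ZMod p) * conj (χ (g : ZMod p)) = 1 := by
    obtain ⟨u, hu⟩ := hu
    rw [← hu, Complex.mul_conj, Complex.normSq_eq_norm_sq, χ.unit_norm_eq_one u]
    simp
  push_cast
  rw [map_mul, map_mul, map_mul]
  linear_combination (χ q₁ * conj (χ q₂) * (‖χ.LFunction 1‖ : ℂ) ^ 2) * h1

theorem exists_norm_twistedMean_sub_le (q₁ q₂ : ℕ) (hq₁ : 1 ≤ q₁) (hq₂ : 1 ≤ q₂) :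
    ∃ C : ℝ, ∀ (p : ℕ) [Fact p.Prime], 3 ≤ p →
      ∀ H : Subgroup (ZMod p)ˣ, Odd (Nat.card H) →
        ‖twistedMean q₁ q₂ p H -
            ((Real.pi ^ 2 / 6 * ((Nat.gcd q₁ q₂ : ℝ) ^ 2 / ((q₁ : ℝ) * (q₂ : ℝ))) : ℝ) : ℂ)‖ ≤
          C * ((Nat.card H : ℝ) * Real.log (p : ℝ) ^ 2 *
            (p : ℝ) ^ (-(1 / (Nat.totient (Nat.card H) : ℝ)))) := by
  obtain ⟨g, a, b, hg, hab, rfl, rfl⟩ := Nat.exists_coprime' (Nat.gcd_pos_of_pos_left q₂ hq₁)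
  have ha : 1 ≤ a := Nat.pos_of_mul_pos_right hq₁
  have hb : 1 ≤ b := Nat.pos_of_mul_pos_right hq₂
  have haR : (1 : ℝ) ≤ a := by exact_mod_cast ha
  have hbR : (1 : ℝ) ≤ b := by exact_mod_cast hb
  have hgR : (0 : ℝ) < g := by exact_mod_cast hg
  have hgcd : (Nat.gcd (a * g) (b * g) : ℝ) ^ 2 / (((a * g : ℕ) : ℝ) * ((b * g : ℕ) : ℝ)) =
      1 / (a * b) := by
    rw [Nat.gcd_mul_right, hab.gcd_eq_one, one_mul]
    push_cast
    field_simp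
  rw [hgcd]
  -- The first entry serves primes not dividing `q₁q₂`, after cancelling `g`; the second serves
  -- those dividing it.
  refine ⟨max (160 * (a + b)) (2 * ((a * g : ℕ) * (b * g : ℕ))), fun p _ hp3 H hH ↦ ?_⟩
  by_cases hdvd : p ∣ a * g * (b * g)
  · refine (norm_twistedMean_sub_le_of_dvd hp3 hq₁ hq₂ hdvd H hH (by positivity) ?_).trans ?_
    · exact div_le_one_of_le₀ (one_le_mul_of_one_le_of_one_le haR hbR) (by positivity)
    · gcongr
      exact le_max_right _ _
  · have h1 : ¬ p ∣ g := fun h ↦ hdvd ((h.mul_left _).mul_right _)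
    have h2 : ¬ p ∣ a * b := fun h ↦ hdvd (h.trans ⟨g * g, by ring⟩)
    rw [mul_comm a, mul_comm b, twistedMean_mul_left h1]
    have := norm_twistedMean_sub_le_of_coprime_of_not_dvd hp3 ha hb hab h2 H hH
    rw [show Real.pi ^ 2 / 6 * (1 / ((a : ℝ) * b)) = Real.pi ^ 2 / (6 * a * b) by field_simp]
    refine this.trans ?_
    gcongr
    exact le_max_left _ _

theorem mainTheorem3 :
    (∀ q₁ q₂ : ℕ, 1 ≤ q₁ → 1 ≤ q₂ → Nat.Coprime q₁ q₂ →
      ∃ C : ℝ, ∀ (p : ℕ) [Fact p.Prime], 3 ≤ p →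
        ∀ H : Subgroup (ZMod p)ˣ, Odd (Nat.card H) →
          ‖twistedMean q₁ q₂ p H - ((Real.pi ^ 2 / (6 * (q₁ : ℝ) * (q₂ : ℝ)) : ℝ) : ℂ)‖ ≤
            C * ((Nat.card H : ℝ) * Real.log (p : ℝ) ^ 2 *
              (p : ℝ) ^ (-(1 / (Nat.totient (Nat.card H) : ℝ))))) ∧
    (∀ q₁ q₂ : ℕ, 1 ≤ q₁ → 1 ≤ q₂ →
      ∃ C : ℝ, ∀ (p : ℕ) [Fact p.Prime], 3 ≤ p →
        ∀ H : Subgroup (ZMod p)ˣ, Odd (Nat.card H) →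
          ‖twistedMean q₁ q₂ p H -
              ((Real.pi ^ 2 / 6 * ((Nat.gcd q₁ q₂ : ℝ) ^ 2 / ((q₁ : ℝ) * (q₂ : ℝ))) : ℝ) : ℂ)‖ ≤
            C * ((Nat.card H : ℝ) * Real.log (p : ℝ) ^ 2 *
              (p : ℝ) ^ (-(1 / (Nat.totient (Nat.card H) : ℝ))))) := by

  refine ⟨fun q₁ q₂ hq₁ hq₂ hq ↦ ?_, exists_norm_twistedMean_sub_le⟩
  have h := exists_norm_twistedMean_sub_le q₁ q₂ hq₁ hq₂
  have e : Real.pi ^ 2 / 6 * ((Nat.gcd q₁ q₂ : ℝ) ^ 2 / ((q₁ : ℝ) * (q₂ : ℝ))) =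
      Real.pi ^ 2 / (6 * (q₁ : ℝ) * (q₂ : ℝ)) := by
    rw [hq.gcd_eq_one, Nat.cast_one, one_pow]
    field_simp
  rwa [e] at h
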